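/- **Setting.** Let $S$ be a set of colours. A (coloured) tree is a finite rooted planar binary tree whose interior vertices are labelled by elements of $S$; a forest with $r\ge 1$ roots and $l$ leaves is a list $(f_1,\dots,f_r)$ of trees with $l$ leaves in total, the leaves being numbered from left to right. The composite $f\circ g$ is formed when the number of leaves of $f$ equals the number of roots of $g$, by gluing the $i$-th tree of $g$ to the $i$-th leaf of $f$; the tensor product $f\otimes g$ is concatenation of lists. Let $R$ be a set of pairs $(u,v)$ of trees having the same number of leaves, and let $\mathcal F=\mathrm{FS}\langle S|R\rangle$ be the category with objects the positive integers whose morphisms are the forests modulo the smallest equivalence relation containing $R$ and closed under $\circ$ and $\otimes$. Assume that $\mathcal F$ is Ore: $f\circ g=f\circ h$ implies $g=h$, and for all $f,g$ with the same number of roots there are $p,q$ with $f\circ p=g\circ q$. Let $\mathcal F^V$ be the category of symmetric forests, i.e. pairs $(f,\sigma)$ with $f\in\mathcal F$ having $l$ leaves and $\sigma\in\Sigma_l$, with composition $(f,\sigma)\circ(g,\tau)=(f\circ g^\sigma,\sigma^g\circ\tau)$; here $g^\sigma$ is the forest whose $\sigma(j)$-th tree is the $j$-th tree of $g$, and $\sigma^g$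 is the permutation obtained from $\sigma$ by splitting its $j$-th strand into as many parallel strands as the $j$-th tree of $g$ has leaves. Let $\mathcal F^T\subset\mathcal F^V$ be the subcategory of pairs $(f,\sigma)$ with $\sigma$ in the cyclic group $C_l\subset\Sigma_l$ generated by the rotation $(1\,2\,\cdots\,l)$. These categories are again Ore. For $Y\in\{T,V\}$ let $G^Y$ be the group of fractions $[x,y]=x\circ y^{-1}$, where $x,y\in\mathcal F^Y$ have one root and the same number of leaves, modulo $[x,y]=[x\circ p,y\circ p]$, with product $[x,y]\circ[z,w]=[x\circ p,w\circ q]$ whenever $y\circ p=z\circ q$. Every element of $G^Y$ has the form $[t\pi,s]=t\circ\pi\circ s^{-1}$, where $t,s$ are trees over $S$ with the same number $n$ of leaves and $\pi\in C_n$ if $Y=T$, $\pi\in\Sigma_n$ if $Y=V$. Let $\mathbf Z^S$ be the free abelian group on $S$, and for a tree $t$ let $\chi(t)\in\mathbf Z^S$ be such that $\chi(t)(b)$ is the number of $b$-coloured vertices of $t$, for each $b\in S$. **Theorem.** For every colour $a\in S$ and each $Y\in\{T,V\}$ the map $$G^Y\to \mathbf Z^S/\langle \chi(u)=\chi(v),\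 a=0 : (u,v)\in R\rangle,\qquad t\circ\pi\circ s^{-1}\mapsto \chi(t)-\chi(s),$$ is well defined and induces an isomorphism on the abelianisation $G^Y_{\rm ab}$. In particular $$G^T_{\rm ab}\cong G^V_{\rm ab}\cong \mathbf Z^S/\langle \chi(u)=\chi(v),\ a=0 : (u,v)\in R\rangle.$$ -/

import Mathlib

open CategoryTheory

namespace ForestSkein

universe u v w

/-! ### Ore categories and their fraction groups

Composition of categories is written in the order of `≫`: the composite `f ∘ g` of forests
("stack `g` on the leaves of `f`") is `f ≫ g`; thus the source of a forest is its set of roots. -/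

section Fractions

/-- A category with a right calculus of fractions: it is left-cancellative, and any two morphisms
with the same source have a common right-multiple. -/
class IsOre (C : Type u) [Category.{v} C] : Prop where
  left_cancel : ∀ {x y z : C} (f : x ⟶ y) (g h : y ⟶ z), f ≫ g = f ≫ h → g = h
  common_right_multiple : ∀ {x y z : C} (f : x ⟶ y) (g : x ⟶ z),
    ∃ (w : C) (p : y ⟶ w) (q : z ⟶ w), f ≫ p = g ≫ q

variable {C : Type u} [Category.{v} C]

/-- Pairs `(f, g)` of morphisms out of `c` with the same target. -/
structure FracPair (c : C) where
  tgt : C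
  num : c ⟶ tgt
  den : c ⟶ tgt

/-- The elementary growing move `(f, g) ∼ (f ∘ p, g ∘ p)`. -/
inductive FracPair.Grow {c : C} : FracPair c → FracPair c → Prop
  | grow {y z : C} (f g : c ⟶ y) (p : y ⟶ z) : Grow ⟨y, f, g⟩ ⟨z, f ≫ p, g ≫ p⟩

/-- The underlying set of the isotropy group at `c` of the fraction groupoid. -/
def FracGroup (c : C) : Type (max u v) := Quot (FracPair.Grow (c := c))

namespace FracGroup

variable {c : C}

/-- The fraction `[f, g] = f ∘ g⁻¹`. -/
def frac {y : C} (f g : c ⟶ y) : FracGroup c := Quot.mk _ ⟨y, f, g⟩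

theorem frac_grow {y z : C} (f g : c ⟶ y) (p : y ⟶ z) : frac (f ≫ p) (g ≫ p) = frac f g :=
  (Quot.sound (FracPair.Grow.grow f g p)).symm

theorem frac_surj (x : FracGroup c) : ∃ (y : C) (f g : c ⟶ y), x = frac f g := by
  induction x using Quot.ind with
  | mk a => exact ⟨a.tgt, a.num, a.den, rfl⟩

section
variable [IsOre C]

theorem frac_mul_aux {y y' w w' : C} (f g : c ⟶ y) (h k : c ⟶ y')
    (p : y ⟶ w) (q : y' ⟶ w) (e : g ≫ p = h ≫ q)
    (p' : y ⟶ w') (q' : y' ⟶ w') (e' : g ≫ p' = h ≫ q') :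
    frac (f ≫ p) (k ≫ q) = frac (f ≫ p') (k ≫ q') := by
  obtain ⟨v, x, x', hx⟩ := IsOre.common_right_multiple (g ≫ p) (g ≫ p')
  have h1 : p ≫ x = p' ≫ x' := IsOre.left_cancel g _ _ (by simpa using hx)
  have h2 : q ≫ x = q' ≫ x' := IsOre.left_cancel h _ _ (by
    rw [e, e'] at hx; simpa using hx)
  rw [← frac_grow (f ≫ p) (k ≫ q) x, ← frac_grow (f ≫ p') (k ≫ q') x']
  simp only [Category.assoc, h1, h2]

/-- The product of two pairs: `[f, g] ∘ [h, k] = [f ∘ p, k ∘ q]` for some (equivalently any)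
`p`, `q` with `g ∘ p = h ∘ q`. -/
noncomputable def mulPair (a b : FracPair c) : FracGroup c :=
  let H := IsOre.common_right_multiple a.den b.num
  frac (a.num ≫ H.choose_spec.choose) (b.den ≫ H.choose_spec.choose_spec.choose)

theorem mulPair_eq {y y' w : C} (f g : c ⟶ y) (h k : c ⟶ y') (p : y ⟶ w) (q : y' ⟶ w)
    (e : g ≫ p = h ≫ q) : mulPair ⟨y, f, g⟩ ⟨y', h, k⟩ = frac (f ≫ p) (k ≫ q) :=
  frac_mul_aux f g h k _ _
    (IsOre.common_right_multiple g h).choose_spec.choose_spec.choose_spec p q e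

noncomputable instance : Mul (FracGroup c) where
  mul := Quot.lift₂ mulPair
    (by
      rintro ⟨y, f, g⟩ _ _ ⟨h, k, r⟩
      obtain ⟨w, p, q, e⟩ := IsOre.common_right_multiple g (h ≫ r)
      rw [mulPair_eq f g (h ≫ r) (k ≫ r) p q e,
        mulPair_eq f g h k p (r ≫ q) (by simpa using e)]
      simp)
    (by
      rintro _ _ ⟨y', h, k⟩ ⟨f, g, r⟩
      obtain ⟨w, p, q, e⟩ := IsOre.common_right_multiple (g ≫ r) h
      rw [mulPair_eq (f ≫ r) (g ≫ r) h k p q e,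
        mulPair_eq f g h k (r ≫ p) q (by simpa using e)]
      simp)

/-- `[f, g] ∘ [h, k] = [f ∘ p, k ∘ q]` whenever `g ∘ p = h ∘ q`. -/
theorem frac_mul {y y' w : C} (f g : c ⟶ y) (h k : c ⟶ y') (p : y ⟶ w) (q : y' ⟶ w)
    (e : g ≫ p = h ≫ q) : frac f g * frac h k = frac (f ≫ p) (k ≫ q) :=
  mulPair_eq f g h k p q e

theorem frac_mul_frac {y : C} (f g h : c ⟶ y) : frac f g * frac g h = frac f h := by
  rw [frac_mul f g g h (𝟙 _) (𝟙 _) rfl]; simp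

theorem frac_self {y y' : C} (f : c ⟶ y) (g : c ⟶ y') : frac f f = frac g g := by
  obtain ⟨w, p, q, e⟩ := IsOre.common_right_multiple f g
  rw [← frac_grow f f p, ← frac_grow g g q, e]

/-- Common denominators. -/
theorem frac_common {y y' : C} (f g : c ⟶ y) (h k : c ⟶ y') :
    ∃ (w : C) (f' m k' : c ⟶ w), frac f g = frac f' m ∧ frac h k = frac m k' := by
  obtain ⟨w, p, q, e⟩ := IsOre.common_right_multiple g h
  refine ⟨w, f ≫ p, g ≫ p, k ≫ q, (frac_grow _ _ _).symm, ?_⟩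
  rw [e, frac_grow]

/-- The group structure of the isotropy group at `c` of the fraction groupoid:
`[f, g]⁻¹ = [g, f]`, and the neutral element is `[𝟙, 𝟙]`. -/
noncomputable instance instGroup : Group (FracGroup c) where
  mul_assoc x y z := by
    obtain ⟨_, f, g, rfl⟩ := frac_surj x
    obtain ⟨_, h, k, rfl⟩ := frac_surj y
    obtain ⟨_, h', k', rfl⟩ := frac_surj z
    obtain ⟨w, p, q, e⟩ := IsOre.common_right_multiple g h
    obtain ⟨w', p', q', e'⟩ := IsOre.common_right_multiple (k ≫ q) h'
    rw [frac_mul f g h k p q e, frac_mul (f ≫ p) (k ≫ q) h' k' p' q' e',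
      frac_mul h k h' k' (q ≫ p') q' (by simpa using e'),
      frac_mul f g _ _ (p ≫ p') (𝟙 _) (by rw [← Category.assoc, e]; simp)]
    simp
  one := frac (𝟙 c) (𝟙 c)
  one_mul x := by
    obtain ⟨_, f, g, rfl⟩ := frac_surj x
    exact (congrArg (· * frac f g) (frac_self (𝟙 c) f)).trans (frac_mul_frac f f g)
  mul_one x := by
    obtain ⟨_, f, g, rfl⟩ := frac_surj x
    exact (congrArg (frac f g * ·) (frac_self (𝟙 c) g)).trans (frac_mul_frac f g g)
  inv := Quot.lift (fun a => frac a.den a.num) (by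
    rintro _ _ ⟨f, g, p⟩
    exact (frac_grow g f p).symm)
  inv_mul_cancel x := by
    obtain ⟨_, f, g, rfl⟩ := frac_surj x
    exact (frac_mul_frac g f g).trans (frac_self g (𝟙 c))

theorem frac_inv {y : C} (f g : c ⟶ y) : (frac f g)⁻¹ = frac g f := rfl

theorem one_def : (1 : FracGroup c) = frac (𝟙 c) (𝟙 c) := rfl

end

end FracGroup

end Fractions

/-! ### Free coloured trees and forests -/

variable {S : Type u}

/-- Finite rooted planar binary trees with interior vertices coloured by `S`. -/
inductive Tree (S : Type u) : Type u
  | leaf : Tree S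
  | node (c : S) (left right : Tree S) : Tree S

namespace Tree

/-- Number of leaves. -/
@[simp] def leaves : Tree S → ℕ
  | leaf => 1
  | node _ l r => l.leaves + r.leaves

/-- The colour counting map: `t.count b` is the number of `b`-coloured vertices of `t`. -/
noncomputable def count : Tree S → (S →₀ ℤ)
  | leaf => 0
  | node c l r => Finsupp.single c 1 + l.count + r.count

/-- `t.graft g` glues the tree `g k` to the `k`-th leaf of `t`, leaves counted from left to
right. -/
def graft : (t : Tree S) → (Fin t.leaves → Tree S) → Tree S
  | leaf, g => g (0 : Fin 1)
  | node c l r, g =>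
    node c (l.graft fun k => g (Fin.castAdd r.leaves k)) (r.graft fun k => g (Fin.natAdd l.leaves k))

theorem leaves_pos (t : Tree S) : 0 < t.leaves := by
  induction t with
  | leaf => exact Nat.one_pos
  | node c l r hl hr => simp only [leaves]; omega

theorem leaves_graft (t : Tree S) (g : Fin t.leaves → Tree S) :
    (t.graft g).leaves = ∑ k, (g k).leaves := by
  induction t with
  | leaf => exact (Fin.sum_univ_one fun k => (g k).leaves).symm
  | node c l r hl hr =>
    have h := Fin.sum_univ_add (a := l.leaves) (b := r.leaves) fun k => (g k).leaves
    simp only [graft, leaves, hl, hr]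
    exact h.symm

theorem graft_leaf (t : Tree S) : t.graft (fun _ => leaf) = t := by
  induction t with
  | leaf => rfl
  | node c l r hl hr => simp only [graft, hl, hr]

theorem graft_graft (t : Tree S) (g h : ℕ → Tree S) :
    (t.graft fun k => g k).graft (fun k => h k) =
      t.graft fun k => (g k).graft fun m =>
        h ((∑ i ∈ Finset.range k, (g i).leaves) + m) := by
  induction t generalizing g h with
  | leaf => simp [graft]
  | node c l r hl hr =>
    simp only [graft, Fin.val_castAdd, Fin.val_natAdd]
    rw [hl g h, hr (fun k => g (l.leaves + k)) (fun k => h ((l.graft fun k => g k).leaves + k))]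
    congr 1
    congr 1
    funext k
    congr 1
    funext m
    congr 1
    rw [leaves_graft, Finset.sum_range_add, Finset.sum_range (fun i => (g i).leaves)]
    omega

end Tree

/-- A free coloured forest with `r` roots and `l` leaves: a list of `r` coloured trees having `l`
leaves altogether. -/
@[ext] structure Forest (S : Type u) (r l : ℕ) where
  tree : Fin r → Tree S
  sum_leaves : ∑ i, (tree i).leaves = l

namespace Forest

variable {r l m n r' l' : ℕ}

/-- Identification of the leaves of `f` with `{0, …, l - 1}`: the `k`-th leaf of the `i`-th tree
comes after all leaves of the earlier trees and the earlier leaves of the same tree. -/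
def leafEquiv (f : Forest S r l) : (Σ i : Fin r, Fin (f.tree i).leaves) ≃ Fin l :=
  finSigmaFinEquiv.trans (finCongr f.sum_leaves)

/-- The trivial forest with `n` roots. -/
def id (S : Type u) (n : ℕ) : Forest S n n := ⟨fun _ => Tree.leaf, by simp⟩

/-- The composition `f ∘ g`: glue the `i`-th tree of `g` to the `i`-th leaf of `f`. -/
def comp (f : Forest S r m) (g : Forest S m l) : Forest S r l where
  tree i := (f.tree i).graft fun k => g.tree (f.leafEquiv ⟨i, k⟩)
  sum_leaves := by
    simp only [Tree.leaves_graft]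
    have h := f.leafEquiv.sum_comp fun i => (g.tree i).leaves
    rw [Fintype.sum_sigma, g.sum_leaves] at h
    exact h

/-- The tensor product: horizontal concatenation. -/
def tensor (f : Forest S r l) (g : Forest S r' l') : Forest S (r + r') (l + l') where
  tree := Fin.append f.tree g.tree
  sum_leaves := by rw [Fin.sum_univ_add]; simp [f.sum_leaves, g.sum_leaves]

/-- A tree, as a forest with one root. -/
def single (t : Tree S) (h : t.leaves = l) : Forest S 1 l := ⟨fun _ => t, by simpa using h⟩

/-- The number of `b`-coloured vertices of the forest, for each colour `b`. -/
noncomputable def count (f : Forest S r l) : S →₀ ℤ := ∑ i, (f.tree i).count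

/-- The forest `f^π`, whose `π j`-th tree is the `j`-th tree of `f`. -/
def perm (f : Forest S r l) (π : Equiv.Perm (Fin r)) : Forest S r l where
  tree i := f.tree (π.symm i)
  sum_leaves := by rw [π.symm.sum_comp fun i => (f.tree i).leaves]; exact f.sum_leaves

/-- The permutation `π^f`, obtained from `π` by splitting its `j`-th strand into as many parallel
strands as the `j`-th tree of `f` has leaves: the `k`-th leaf of the `j`-th tree of `f` is sent to
the `k`-th leaf of the `π j`-th tree of `f^π`. -/
def split (π : Equiv.Perm (Fin r)) (f : Forest S r l) : Equiv.Perm (Fin l) :=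
  (f.leafEquiv.symm.trans
    (Equiv.sigmaCongr π fun j => finCongr (by simp [perm]))).trans (f.perm π).leafEquiv

end Forest

namespace Tree

/-- The leaves of `t.graft g` are the leaves of the trees `g k`, read from left to right. -/
def graftEquiv (t : Tree S) (g : Fin t.leaves → Tree S) :
    (Σ k, Fin (g k).leaves) ≃ Fin (t.graft g).leaves :=
  finSigmaFinEquiv.trans (finCongr (t.leaves_graft g).symm)

end Tree

theorem sum_castLE_eq {n i : ℕ} (h : i ≤ n) (a : Fin n → ℕ) (b : ℕ → ℕ)
    (hab : ∀ j : Fin n, b j = a j) :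
    ∑ j : Fin i, a (Fin.castLE h j) = ∑ j ∈ Finset.range i, b j := by
  rw [Finset.sum_range]
  exact Finset.sum_congr rfl fun j _ => (hab (Fin.castLE h j)).symm

theorem Tree.graftEquiv_val (t : Tree S) (g : Fin t.leaves → Tree S) (g' : ℕ → Tree S)
    (hg : ∀ k : Fin t.leaves, g' k = g k) (k : Fin t.leaves) (m : Fin (g k).leaves) :
    (t.graftEquiv g ⟨k, m⟩ : ℕ) = (∑ j ∈ Finset.range k, (g' j).leaves) + m := by
  simp only [Tree.graftEquiv, Equiv.trans_apply, finCongr_apply, Fin.val_cast,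
    finSigmaFinEquiv_apply]
  rw [sum_castLE_eq _ (fun j => (g j).leaves) (fun j => (g' j).leaves)]
  intro j
  simp only [hg]

theorem exists_extend {n : ℕ} (g : Fin n → Tree S) :
    ∃ g' : ℕ → Tree S, ∀ k : Fin n, g' k = g k :=
  ⟨fun k => if h : k < n then g ⟨k, h⟩ else Tree.leaf, fun k => by simp⟩

theorem Tree.graft_assoc (t : Tree S) (g : Fin t.leaves → Tree S)
    (h : Fin (t.graft g).leaves → Tree S) :
    (t.graft g).graft h =
      t.graft fun k => (g k).graft fun m => h (t.graftEquiv g ⟨k, m⟩) := by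
  obtain ⟨g', hg⟩ := exists_extend g
  obtain ⟨h', hh⟩ := exists_extend h
  obtain rfl : (fun k : Fin t.leaves => g' k) = g := funext hg
  obtain rfl : (fun k : Fin (t.graft fun k => g' k).leaves => h' k) = h := funext hh
  rw [t.graft_graft g' h']
  congr 1
  funext k
  congr 1
  funext m
  exact congrArg h' (Tree.graftEquiv_val t _ g' (fun _ => rfl) k m).symm

namespace Forest

variable {r l m n r' l' : ℕ}

theorem leafEquiv_val (f : Forest S r l) (f' : ℕ → Tree S) (hf : ∀ i : Fin r, f' i = f.tree i)
    (i : Fin r) (k : Fin (f.tree i).leaves) :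
    (f.leafEquiv ⟨i, k⟩ : ℕ) = (∑ j ∈ Finset.range i, (f' j).leaves) + k := by
  simp only [leafEquiv, Equiv.trans_apply, finCongr_apply, Fin.val_cast, finSigmaFinEquiv_apply]
  rw [sum_castLE_eq _ (fun j => (f.tree j).leaves) (fun j => (f' j).leaves)]
  intro j
  simp only [hf]

theorem leafEquiv_congr {f f' : Forest S r l} (hf : ∀ i, (f.tree i).leaves = (f'.tree i).leaves)
    {i i' : Fin r} (hi : i = i') (k : Fin (f.tree i).leaves) (k' : Fin (f'.tree i').leaves)
    (hk : (k : ℕ) = k') : f.leafEquiv ⟨i, k⟩ = f'.leafEquiv ⟨i', k'⟩ := by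
  subst hi
  obtain ⟨g, hg⟩ := exists_extend f.tree
  obtain ⟨g', hg'⟩ := exists_extend f'.tree
  apply Fin.ext
  rw [leafEquiv_val f g hg, leafEquiv_val f' g' hg', hk]
  congr 1
  apply Finset.sum_congr rfl
  intro j hj
  have hj' : j < r := (Finset.mem_range.1 hj).trans i.2
  have h1 := hg ⟨j, hj'⟩
  have h2 := hg' ⟨j, hj'⟩
  simp only at h1 h2
  rw [h1, h2, hf]

theorem leafEquiv_surj (f : Forest S r l) (x : Fin l) :
    ∃ (i : Fin r) (k : Fin (f.tree i).leaves), f.leafEquiv ⟨i, k⟩ = x :=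
  ⟨(f.leafEquiv.symm x).1, (f.leafEquiv.symm x).2, by simp⟩

theorem comp_leafEquiv (f : Forest S r m) (g : Forest S m l) (i : Fin r)
    (k : Fin (f.tree i).leaves) (p : Fin (g.tree (f.leafEquiv ⟨i, k⟩)).leaves) :
    (f.comp g).leafEquiv ⟨i, (f.tree i).graftEquiv _ ⟨k, p⟩⟩ =
      g.leafEquiv ⟨f.leafEquiv ⟨i, k⟩, p⟩ := by
  obtain ⟨f', hf⟩ := exists_extend f.tree
  obtain ⟨g', hg⟩ := exists_extend g.tree
  let off : ℕ → ℕ := fun j => ∑ i ∈ Finset.range j, (f' i).leaves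
  have hpos : ∀ (j : Fin r) (q : Fin (f.tree j).leaves),
      g.tree (f.leafEquiv ⟨j, q⟩) = g' (off j + q) := by
    intro j q
    rw [← hg, leafEquiv_val f f' hf]
  have hfg : ∀ j : Fin r, (f' j).graft (fun q => g' (off j + q)) = (f.comp g).tree j := by
    intro j
    rw [hf j]
    simp only [comp, hpos]
  apply Fin.ext
  refine (leafEquiv_val (f.comp g) (fun j => (f' j).graft (fun q => g' (off j + q))) hfg i
    _).trans ?_
  rw [leafEquiv_val g g' hg, leafEquiv_val f f' hf,
    Tree.graftEquiv_val _ _ (fun q => g' (off i + q)) (fun q => (hpos i q).symm),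
    Finset.sum_range_add, ← add_assoc]
  congr 2
  have key : ∀ j : ℕ, ∑ x ∈ Finset.range j, ((f' x).graft fun q => g' (off x + q)).leaves =
      ∑ x ∈ Finset.range (off j), (g' x).leaves := by
    intro j
    induction j with
    | zero => simp [off]
    | succ j ih =>
      have : off (j + 1) = off j + (f' j).leaves := Finset.sum_range_succ _ _
      rw [Finset.sum_range_succ, ih, this, Finset.sum_range_add, Tree.leaves_graft,
        Finset.sum_range (fun x => (g' (off j + x)).leaves)]
  exact key i

theorem comp_assoc (f : Forest S r m) (g : Forest S m n) (h : Forest S n l) :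
    (f.comp g).comp h = f.comp (g.comp h) := by
  ext1
  funext i
  refine (Tree.graft_assoc (f.tree i) _ _).trans ?_
  change _ = (f.tree i).graft fun k => (g.tree _).graft _
  congr 1
  funext k
  congr 1
  funext p
  congr 1
  exact comp_leafEquiv f g i k p

theorem id_leafEquiv (i : Fin n) (k : Fin ((id S n).tree i).leaves) :
    (id S n).leafEquiv ⟨i, k⟩ = i := by
  apply Fin.ext
  rw [leafEquiv_val _ (fun _ => Tree.leaf) (fun _ => rfl)]
  have : (k : ℕ) = 0 := Nat.lt_one_iff.1 k.2
  simp [this]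

theorem id_comp (f : Forest S r l) : (id S r).comp f = f := by
  ext1
  funext i
  exact congrArg f.tree (id_leafEquiv i _)

theorem comp_id (f : Forest S r l) : f.comp (id S l) = f := by
  ext1
  funext i
  exact Tree.graft_leaf _

theorem perm_one (f : Forest S r l) : f.perm 1 = f := rfl

theorem perm_mul (f : Forest S r l) (σ τ : Equiv.Perm (Fin r)) :
    f.perm (σ * τ) = (f.perm τ).perm σ := rfl

theorem perm_id (π : Equiv.Perm (Fin n)) : (id S n).perm π = id S n := rfl

theorem split_apply (π : Equiv.Perm (Fin r)) (f : Forest S r l) (i : Fin r)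
    (k : Fin (f.tree i).leaves) (k' : Fin ((f.perm π).tree (π i)).leaves)
    (h : (k : ℕ) = k') :
    split π f (f.leafEquiv ⟨i, k⟩) = (f.perm π).leafEquiv ⟨π i, k'⟩ := by
  simp only [split, Equiv.trans_apply, Equiv.symm_apply_apply]
  exact leafEquiv_congr (fun _ => rfl) rfl _ _ h

theorem split_symm_apply (π : Equiv.Perm (Fin r)) (f : Forest S r l) (i : Fin r)
    (k : Fin ((f.perm π).tree i).leaves) :
    (split π f).symm ((f.perm π).leafEquiv ⟨i, k⟩) = f.leafEquiv ⟨π.symm i, k⟩ := by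
  rw [Equiv.symm_apply_eq]
  have h : (k : ℕ) < ((f.perm π).tree (π (π.symm i))).leaves := by
    simpa [perm] using k.2
  rw [split_apply π f (π.symm i) k ⟨k, h⟩ rfl]
  exact leafEquiv_congr (fun _ => rfl) (by simp) _ _ rfl

theorem split_ext (π : Equiv.Perm (Fin r)) (f : Forest S r l) (ρ : Equiv.Perm (Fin l))
    (h : ∀ (i : Fin r) (k : Fin ((f.perm π).tree i).leaves),
      ρ.symm ((f.perm π).leafEquiv ⟨i, k⟩) = f.leafEquiv ⟨π.symm i, k⟩) :
    split π f = ρ := by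
  have : (split π f).symm = ρ.symm := by
    ext1 x
    obtain ⟨i, k, rfl⟩ := (f.perm π).leafEquiv_surj x
    rw [split_symm_apply, h]
  exact Equiv.symm_bijective.1 this

theorem split_one (f : Forest S r l) : split 1 f = 1 :=
  split_ext _ _ _ fun _ _ => rfl

theorem split_id (π : Equiv.Perm (Fin n)) : split π (id S n) = π :=
  split_ext _ _ _ fun i k => by
    exact (congrArg π.symm (id_leafEquiv i k)).trans (id_leafEquiv (π.symm i) k).symm

theorem split_mul (σ τ : Equiv.Perm (Fin r)) (f : Forest S r l) :
    split (σ * τ) f = split σ (f.perm τ) * split τ f :=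
  split_ext _ _ _ fun i k => by
    exact (congrArg (split τ f).symm (split_symm_apply σ (f.perm τ) i k)).trans
      (split_symm_apply τ f (σ.symm i) k)

theorem perm_comp (π : Equiv.Perm (Fin r)) (f : Forest S r m) (g : Forest S m l) :
    (f.comp g).perm π = (f.perm π).comp (g.perm (split π f)) := by
  ext1
  funext i
  change (f.tree (π.symm i)).graft _ = (f.tree (π.symm i)).graft _
  congr 1
  funext k
  exact congrArg g.tree (split_symm_apply π f i k).symm

theorem split_comp (π : Equiv.Perm (Fin r)) (f : Forest S r m) (g : Forest S m l) :
    split π (f.comp g) = split (split π f) g :=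
  split_ext _ _ _ fun i q => by
    obtain ⟨⟨k, p⟩, rfl⟩ := ((f.tree (π.symm i)).graftEquiv _).surjective q
    have e := split_symm_apply π f i k
    have hp : (p : ℕ) < ((g.perm (split π f)).tree ((f.perm π).leafEquiv ⟨i, k⟩)).leaves := by
      change _ < (g.tree ((split π f).symm _)).leaves
      rw [e]
      exact p.2
    have e2 : ((f.comp g).perm π).leafEquiv ⟨i, (f.tree (π.symm i)).graftEquiv _ ⟨k, p⟩⟩ =
        (g.perm (split π f)).leafEquiv ⟨(f.perm π).leafEquiv ⟨i, k⟩, ⟨p, hp⟩⟩ := by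
      rw [← comp_leafEquiv (f.perm π) (g.perm (split π f)) i k ⟨p, hp⟩]
      refine leafEquiv_congr (fun j => by rw [perm_comp]) rfl _ _ ?_
      obtain ⟨g', hg⟩ := exists_extend
        fun k : Fin (f.tree (π.symm i)).leaves => g.tree (f.leafEquiv ⟨π.symm i, k⟩)
      rw [Tree.graftEquiv_val _ _ g' hg]
      refine (Tree.graftEquiv_val (f.tree (π.symm i)) _ g' ?_ k ⟨p, hp⟩).symm
      intro k'
      rw [hg]
      exact congrArg g.tree (split_symm_apply π f i k').symm
    refine (congrArg (split (split π f) g).symm e2).trans ?_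
    refine (split_symm_apply (split π f) g _ ⟨p, hp⟩).trans ?_
    refine Eq.trans ?_ (comp_leafEquiv f g (π.symm i) k p).symm
    exact leafEquiv_congr (fun _ => rfl) e _ _ rfl

theorem split_congr {f f' : Forest S r l} (hf : ∀ i, (f.tree i).leaves = (f'.tree i).leaves)
    (π : Equiv.Perm (Fin r)) : split π f = split π f' :=
  split_ext _ _ _ fun i k => by
    have hk : (k : ℕ) < (f'.tree (π.symm i)).leaves := by
      rw [← hf]
      exact k.2
    rw [leafEquiv_congr (f' := f'.perm π) (fun j => hf (π.symm j)) rfl k ⟨k, hk⟩ rfl,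
      split_symm_apply]
    exact (leafEquiv_congr hf rfl _ _ rfl).symm

end Forest

/-! ### Presented forest-skein categories -/

/-- A skein presentation `⟨S | R⟩`: the set `R` of skein relations consists of pairs of coloured
trees with the same number of leaves. -/
structure SkeinPresentation (S : Type u) where
  rel : Set (Tree S × Tree S)
  leaves_eq : ∀ p ∈ rel, p.1.leaves = p.2.leaves

namespace SkeinPresentation

variable (P : SkeinPresentation S) {r l m n r' l' : ℕ}

/-- The smallest equivalence relation on free forests which contains the skein relations and is
closed under composition and tensor product. -/
inductive Cong : ∀ {r l : ℕ}, Forest S r l → Forest S r l → Prop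
  | of {u v : Tree S} {l : ℕ} (h : (u, v) ∈ P.rel) (hu : u.leaves = l) (hv : v.leaves = l) :
      Cong (Forest.single u hu) (Forest.single v hv)
  | refl {r l : ℕ} (f : Forest S r l) : Cong f f
  | symm {r l : ℕ} {f g : Forest S r l} : Cong f g → Cong g f
  | trans {r l : ℕ} {f g h : Forest S r l} : Cong f g → Cong g h → Cong f h
  | comp {r m l : ℕ} {f f' : Forest S r m} {g g' : Forest S m l} :
      Cong f f' → Cong g g' → Cong (f.comp g) (f'.comp g')
  | tensor {r l r' l' : ℕ} {f f' : Forest S r l} {g g' : Forest S r' l'} :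
      Cong f f' → Cong g g' → Cong (f.tensor g) (f'.tensor g')

/-- The congruence on single trees; see `cong_iff`. -/
inductive TreeCong : Tree S → Tree S → Prop
  | of {u v : Tree S} (h : (u, v) ∈ P.rel) : TreeCong u v
  | refl (t : Tree S) : TreeCong t t
  | symm {t t' : Tree S} : TreeCong t t' → TreeCong t' t
  | trans {t t' t'' : Tree S} : TreeCong t t' → TreeCong t' t'' → TreeCong t t''
  | graft {t t' : Tree S} {g g' : ℕ → Tree S} : TreeCong t t' → (∀ k, TreeCong (g k) (g' k)) →
      TreeCong (t.graft fun k => g k) (t'.graft fun k => g' k)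

variable {P}

theorem TreeCong.leaves_eq {t t' : Tree S} (h : P.TreeCong t t') : t.leaves = t'.leaves := by
  induction h with
  | of h => exact P.leaves_eq _ h
  | refl t => rfl
  | symm _ ih => exact ih.symm
  | trans _ _ ih ih' => exact ih.trans ih'
  | @graft t t' g g' _ _ ih ih' =>
    rw [Tree.leaves_graft, Tree.leaves_graft, ← Finset.sum_range (fun k => (g k).leaves),
      ← Finset.sum_range (fun k => (g' k).leaves), ih]
    exact Finset.sum_congr rfl fun k _ => ih' k

theorem single_leafEquiv_val (t : Tree S) (h : t.leaves = l) (i : Fin 1)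
    (k : Fin ((Forest.single t h).tree i).leaves) :
    ((Forest.single t h).leafEquiv ⟨i, k⟩ : ℕ) = k := by
  rw [Forest.leafEquiv_val _ (fun _ => t) (fun _ => rfl)]
  simp

theorem Cong.treeCong {f f' : Forest S r l} (h : P.Cong f f') :
    ∀ i, P.TreeCong (f.tree i) (f'.tree i) := by
  induction h with
  | of h hu hv => exact fun _ => TreeCong.of h
  | refl f => exact fun _ => TreeCong.refl _
  | symm _ ih => exact fun i => (ih i).symm
  | trans _ _ ih ih' => exact fun i => (ih i).trans (ih' i)
  | @comp r m l f f' g g' _ _ ih ih' =>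
    intro i
    obtain ⟨G, hG⟩ : ∃ G : ℕ → ℕ, ∀ k : Fin (f.tree i).leaves, G k = f.leafEquiv ⟨i, k⟩ :=
      ⟨fun k => if h : k < (f.tree i).leaves then f.leafEquiv ⟨i, ⟨k, h⟩⟩ else 0, fun k => by simp⟩
    obtain ⟨e, he⟩ := exists_extend g.tree
    have hlt : ∀ a : ℕ, ∀ b : Fin m, a = b → ∃ h : a < m, (⟨a, h⟩ : Fin m) = b := by
      rintro a b rfl
      exact ⟨b.2, rfl⟩
    let E : ℕ → Tree S := fun k => if h : G k < m then g.tree ⟨G k, h⟩ else Tree.leaf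
    let E' : ℕ → Tree S := fun k => if h : G k < m then g'.tree ⟨G k, h⟩ else Tree.leaf
    have hE : (f.comp g).tree i = (f.tree i).graft fun k => E k := by
      change (f.tree i).graft _ = _
      congr 1
      funext k
      obtain ⟨h1, h2⟩ := hlt _ _ (hG k)
      simp only [E, dif_pos h1, h2]
    have hE' : (f'.comp g').tree i = (f'.tree i).graft fun k => E' k := by
      change (f'.tree i).graft _ = _
      congr 1
      funext k
      have hk : (k : ℕ) < (f.tree i).leaves := by
        rw [(ih i).leaves_eq]
        exact k.2
      obtain ⟨h1, h2⟩ := hlt _ _ (hG ⟨k, hk⟩)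
      simp only [E', dif_pos h1, h2]
      congr 1
      exact (Forest.leafEquiv_congr (fun j => (ih j).leaves_eq) rfl _ _ rfl).symm
    rw [hE, hE']
    refine TreeCong.graft (ih i) fun k => ?_
    by_cases h : G k < m
    · simp only [E, E', dif_pos h]
      exact ih' _
    · simp only [E, E', dif_neg h]
      exact TreeCong.refl _
  | @tensor r l r' l' f f' g g' _ _ ih ih' =>
    intro i
    refine Fin.addCases (fun i => ?_) (fun i => ?_) i
    · simpa [Forest.tensor] using ih i
    · simpa [Forest.tensor] using ih' i

theorem cong_of_single {f f' : Forest S r l}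
    (h : ∀ (i : Fin r) (a : ℕ) (ha : (f.tree i).leaves = a) (ha' : (f'.tree i).leaves = a),
      P.Cong (Forest.single (f.tree i) ha) (Forest.single (f'.tree i) ha'))
    (hl : ∀ i, (f.tree i).leaves = (f'.tree i).leaves) : P.Cong f f' := by
  induction r generalizing l with
  | zero =>
    have : f = f' := by
      ext1
      funext i
      exact i.elim0
    rw [this]
    exact Cong.refl _
  | succ r ih =>
    obtain ⟨T, hT⟩ := f
    obtain ⟨T', hT'⟩ := f'
    simp only at h hl
    rw [Fin.sum_univ_castSucc] at hT
    subst hT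
    have e : ∀ (A : Fin (r + 1) → Tree S) (a b : ℕ) (h1 : ∑ i : Fin r, (A i.castSucc).leaves = a)
        (h2 : (A (Fin.last r)).leaves = b) (h3 : ∑ i, (A i).leaves = a + b),
        (⟨A, h3⟩ : Forest S (r + 1) (a + b)) =
          (⟨fun i : Fin r => A i.castSucc, h1⟩ : Forest S r a).tensor
            (Forest.single (A (Fin.last r)) h2) := by
      intro A a b h1 h2 h3
      ext1
      funext i
      simp only [Forest.tensor, Forest.single]
      refine Fin.lastCases ?_ (fun i => ?_) i
      · exact (Fin.append_right (fun i : Fin r => A i.castSucc) (fun _ : Fin 1 => A (Fin.last r))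
          0).symm
      · exact (Fin.append_left (fun i : Fin r => A i.castSucc) (fun _ : Fin 1 => A (Fin.last r))
          i).symm
    rw [e T _ _ rfl rfl, e T' _ _ (Finset.sum_congr rfl fun i _ => (hl _).symm) (hl _).symm]
    exact Cong.tensor (ih (fun i => h i.castSucc) fun i => hl i.castSucc) (h _ _ _ _)

theorem TreeCong.cong {t t' : Tree S} (h : P.TreeCong t t') (ht : t.leaves = l)
    (ht' : t'.leaves = l) : P.Cong (Forest.single t ht) (Forest.single t' ht') := by
  induction h generalizing l with
  | of h => exact Cong.of h _ _
  | refl t => exact Cong.refl _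
  | symm _ ih => exact (ih _ _).symm
  | trans h h' ih ih' => exact (ih ht (h.leaves_eq ▸ ht)).trans (ih' _ _)
  | @graft t t' g g' h h' ih ih' =>
    have e : ∀ (t : Tree S) (g : ℕ → Tree S) (ht : (t.graft fun k => g k).leaves = l) (m : ℕ)
        (hm : t.leaves = m) (hg : ∑ k : Fin m, (g k).leaves = l), Forest.single _ ht =
          (Forest.single t hm).comp (⟨fun k => g k, hg⟩ : Forest S m l) := by
      intro t g ht m hm hg
      ext1
      funext i
      change t.graft _ = t.graft _
      congr 1
      funext k
      exact congrArg g (single_leafEquiv_val t hm i k).symm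
    have hs : ∀ (t : Tree S) (g : ℕ → Tree S) (ht : (t.graft fun k => g k).leaves = l) (m : ℕ)
        (hm : t.leaves = m), ∑ k : Fin m, (g k).leaves = l := by
      rintro t g ht _ rfl
      rw [← ht, Tree.leaves_graft]
    rw [e t g ht _ rfl (hs t g ht _ rfl),
      e t' g' ht' _ h.leaves_eq.symm (hs t' g' ht' _ h.leaves_eq.symm)]
    exact Cong.comp (ih _ _) (cong_of_single (fun i a ha ha' => ih' i ha ha')
      fun i => (h' i).leaves_eq)

/-- Two forests are congruent if and only if they are so tree by tree. -/
theorem cong_iff {f f' : Forest S r l} :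
    P.Cong f f' ↔ ∀ i, P.TreeCong (f.tree i) (f'.tree i) :=
  ⟨Cong.treeCong, fun h => cong_of_single (fun i _ ha ha' => (h i).cong ha ha')
    fun i => (h i).leaves_eq⟩

theorem Cong.perm {f f' : Forest S r l} (h : P.Cong f f') (π : Equiv.Perm (Fin r)) :
    P.Cong (f.perm π) (f'.perm π) :=
  cong_iff.2 fun i => h.treeCong (π.symm i)

theorem Cong.split {f f' : Forest S r l} (h : P.Cong f f') (π : Equiv.Perm (Fin r)) :
    Forest.split π f = Forest.split π f' :=
  Forest.split_congr (fun i => (h.treeCong i).leaves_eq) π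

variable (P)

/-- The set of forests of `FS⟨S|R⟩` with `r` roots and `l` leaves. -/
def Mor (r l : ℕ) : Type u :=
  Quotient (⟨P.Cong, Cong.refl, Cong.symm, Cong.trans⟩ : Setoid (Forest S r l))

variable {P}

namespace Mor

/-- The class of a free forest. -/
def mk (f : Forest S r l) : P.Mor r l := Quotient.mk _ f

theorem mk_eq {f g : Forest S r l} : (mk f : P.Mor r l) = mk g ↔ P.Cong f g :=
  Quotient.eq (r := ⟨P.Cong, Cong.refl, Cong.symm, Cong.trans⟩)

theorem mk_surj (x : P.Mor r l) : ∃ f, mk f = x := Quotient.exists_rep x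

/-- Composition of forests. -/
def comp : P.Mor r m → P.Mor m l → P.Mor r l :=
  Quotient.map₂ Forest.comp fun _ _ h _ _ h' => Cong.comp h h'

/-- The forest `f^π`. -/
def perm (f : P.Mor r l) (π : Equiv.Perm (Fin r)) : P.Mor r l :=
  Quotient.map (fun f => f.perm π) (fun _ _ h => Cong.perm h π) f

/-- The permutation `π^f`. -/
def split (π : Equiv.Perm (Fin r)) : P.Mor r l → Equiv.Perm (Fin l) :=
  Quotient.lift (Forest.split π) fun _ _ h => Cong.split h π

theorem comp_mk (f : Forest S r m) (g : Forest S m l) :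
    comp (mk f : P.Mor r m) (mk g) = mk (f.comp g) := rfl

theorem perm_mk (f : Forest S r l) (π : Equiv.Perm (Fin r)) :
    perm (mk f : P.Mor r l) π = mk (f.perm π) := rfl

theorem split_mk (f : Forest S r l) (π : Equiv.Perm (Fin r)) :
    split π (mk f : P.Mor r l) = f.split π := rfl

theorem comp_assoc (f : P.Mor r m) (g : P.Mor m n) (h : P.Mor n l) :
    comp (comp f g) h = comp f (comp g h) := by
  obtain ⟨f, rfl⟩ := mk_surj f
  obtain ⟨g, rfl⟩ := mk_surj g
  obtain ⟨h, rfl⟩ := mk_surj h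
  simp only [comp_mk, Forest.comp_assoc]

theorem id_comp (f : P.Mor r l) : comp (mk (Forest.id S r)) f = f := by
  obtain ⟨f, rfl⟩ := mk_surj f
  rw [comp_mk, Forest.id_comp]

theorem comp_id (f : P.Mor r l) : comp f (mk (Forest.id S l)) = f := by
  obtain ⟨f, rfl⟩ := mk_surj f
  rw [comp_mk, Forest.comp_id]

theorem perm_one (f : P.Mor r l) : perm f 1 = f := by
  obtain ⟨f, rfl⟩ := mk_surj f
  rfl

theorem perm_mul (f : P.Mor r l) (σ τ : Equiv.Perm (Fin r)) :
    perm f (σ * τ) = perm (perm f τ) σ := by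
  obtain ⟨f, rfl⟩ := mk_surj f
  rfl

theorem perm_comp (π : Equiv.Perm (Fin r)) (f : P.Mor r m) (g : P.Mor m l) :
    perm (comp f g) π = comp (perm f π) (perm g (split π f)) := by
  obtain ⟨f, rfl⟩ := mk_surj f
  obtain ⟨g, rfl⟩ := mk_surj g
  simp only [comp_mk, perm_mk, split_mk, Forest.perm_comp]

theorem split_one (f : P.Mor r l) : split 1 f = 1 := by
  obtain ⟨f, rfl⟩ := mk_surj f
  exact Forest.split_one f

theorem split_id (π : Equiv.Perm (Fin n)) :
    split π (mk (Forest.id S n) : P.Mor n n) = π := Forest.split_id π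

theorem split_mul (σ τ : Equiv.Perm (Fin r)) (f : P.Mor r l) :
    split (σ * τ) f = split σ (perm f τ) * split τ f := by
  obtain ⟨f, rfl⟩ := mk_surj f
  exact Forest.split_mul σ τ f

theorem split_comp (π : Equiv.Perm (Fin r)) (f : P.Mor r m) (g : P.Mor m l) :
    split π (comp f g) = split (split π f) g := by
  obtain ⟨f, rfl⟩ := mk_surj f
  obtain ⟨g, rfl⟩ := mk_surj g
  exact Forest.split_comp π f g

end Mor

/-- Symmetric forests: a forest with a permutation of its leaves. -/
@[ext] structure SymMor (P : SkeinPresentation S) (r l : ℕ) where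
  forest : P.Mor r l
  perm : Equiv.Perm (Fin l)

namespace SymMor

/-- `(f, σ) ∘ (g, τ) = (f ∘ g^σ, σ^g ∘ τ)`. -/
def comp (x : P.SymMor r m) (y : P.SymMor m l) : P.SymMor r l :=
  ⟨x.forest.comp (y.forest.perm x.perm), y.forest.split x.perm * y.perm⟩

/-- The identity. -/
def id (P : SkeinPresentation S) (n : ℕ) : P.SymMor n n := ⟨Mor.mk (Forest.id S n), 1⟩

theorem comp_assoc (x : P.SymMor r m) (y : P.SymMor m n) (z : P.SymMor n l) :
    (x.comp y).comp z = x.comp (y.comp z) := by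
  ext1
  · simp only [comp, Mor.comp_assoc, Mor.perm_comp, Mor.perm_mul]
  · simp only [comp, Mor.split_mul, Mor.split_comp, mul_assoc]

theorem id_comp (x : P.SymMor r l) : (id P r).comp x = x := by
  ext1
  · simp only [comp, id, Mor.perm_one, Mor.id_comp]
  · simp only [comp, id, Mor.split_one, one_mul]

theorem comp_id (x : P.SymMor r l) : x.comp (id P l) = x := by
  ext1
  · simp only [comp, id]
    exact Mor.comp_id _
  · simp only [comp, id, Mor.split_id, mul_one]

end SymMor

/-! ### Cyclic permutations -/

/-- The cyclic group `C_n` inside the symmetric group `Σ_n`. -/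
def cyclic (n : ℕ) : Subgroup (Equiv.Perm (Fin n)) := Subgroup.zpowers (finRotate n)

theorem finRotate_pow_val (n k : ℕ) (i : Fin n) : ((finRotate n ^ k) i : ℕ) = (i + k) % n := by
  induction k with
  | zero => simp [Nat.mod_eq_of_lt i.2]
  | succ k ih =>
    rw [pow_succ', Equiv.Perm.mul_apply]
    obtain _ | n := n
    · exact i.elim0
    rw [finRotate_apply, Fin.val_add, ih, Fin.val_one', ← Nat.add_mod, add_assoc]

theorem split_finRotate_mem (f : Forest S r l) : f.split (finRotate r) ∈ cyclic l := by
  obtain _ | r := r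
  · have : l = 0 := by rw [← f.sum_leaves]; simp
    subst this
    rw [Subsingleton.elim (f.split (finRotate 0)) 1]
    exact one_mem _
  obtain ⟨f', hf⟩ := exists_extend f.tree
  let off : ℕ → ℕ := fun j => ∑ i ∈ Finset.range j, (f' i).leaves
  have hl : off r + (f' r).leaves = l := by
    rw [← f.sum_leaves, ← Finset.sum_range_succ, Finset.sum_range]
    exact Finset.sum_congr rfl fun i _ => by rw [hf]
  have hlast : (0 : ℕ) < (f' r).leaves := Tree.leaves_pos _
  refine ⟨((f' r).leaves : ℕ), ?_⟩
  simp only [zpow_natCast]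
  ext x
  rw [finRotate_pow_val]
  obtain ⟨i, k, rfl⟩ := f.leafEquiv_surj x
  have hk : (k : ℕ) < ((f.perm (finRotate (r + 1))).tree (finRotate (r + 1) i)).leaves := by
    simpa only [Forest.perm, Equiv.symm_apply_apply] using k.2
  rw [Forest.split_apply _ f i k ⟨k, hk⟩ rfl, f.leafEquiv_val f' hf]
  let f'' : ℕ → Tree S := fun j => if j = 0 then f' r else f' (j - 1)
  have hf'' : ∀ j : Fin (r + 1), f'' j = (f.perm (finRotate (r + 1))).tree j := by
    intro j
    obtain ⟨j, rfl⟩ := (finRotate (r + 1)).surjective j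
    simp only [Forest.perm, Equiv.symm_apply_apply, f'', coe_finRotate]
    by_cases hj : j = Fin.last r
    · subst hj
      simpa using hf (Fin.last r)
    · simpa [hj] using hf j
  rw [Forest.leafEquiv_val _ f'' hf'', coe_finRotate]
  by_cases hi : i = Fin.last r
  · subst hi
    have h2 : (k : ℕ) < (f' r).leaves := by
      have := hf (Fin.last r)
      simp only [Fin.val_last] at this
      rw [this]
      exact k.2
    have : ∑ j ∈ Finset.range ((Fin.last r : Fin (r + 1)) : ℕ), (f' j).leaves = off r := rfl
    rw [this]
    have e : off r + (k : ℕ) + (f' r).leaves = k + l := by omega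
    rw [e, Nat.add_mod_right, Nat.mod_eq_of_lt (by omega)]
    simp
  · have h3 : ∑ j ∈ Finset.range ((i : ℕ) + 1), (f'' j).leaves =
        (∑ j ∈ Finset.range (i : ℕ), (f' j).leaves) + (f' r).leaves := by
      rw [Finset.sum_range_succ']
      simp [f'']
    have hi' : (i : ℕ) < r := Fin.val_lt_last hi
    have h4 : off ((i : ℕ) + 1) ≤ off r :=
      Finset.sum_le_sum_of_subset (Finset.range_mono hi')
    have h5 : off ((i : ℕ) + 1) = off i + (f' i).leaves := Finset.sum_range_succ _ _
    have h6 : (k : ℕ) < (f' i).leaves := by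
      rw [hf i]
      exact k.2
    have h7 : ∑ j ∈ Finset.range (i : ℕ), (f' j).leaves = off i := rfl
    rw [if_neg hi, h3, h7, Nat.mod_eq_of_lt (by omega)]
    simp only
    omega

theorem split_mem_cyclic {π : Equiv.Perm (Fin r)} (hπ : π ∈ cyclic r) (f : P.Mor r l) :
    f.split π ∈ cyclic l := by
  obtain ⟨k, rfl⟩ := mem_powers_iff_mem_zpowers.2 hπ
  suffices H : ∀ (k : ℕ) (f : P.Mor r l), f.split (finRotate r ^ k) ∈ cyclic l from H k f
  intro k
  induction k with
  | zero => intro f; rw [pow_zero, Mor.split_one]; exact one_mem _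
  | succ k ih =>
    intro f
    rw [pow_succ, Mor.split_mul]
    refine mul_mem (ih _) ?_
    obtain ⟨f, rfl⟩ := Mor.mk_surj f
    exact split_finRotate_mem f

/-! ### The categories `FS⟨S|R⟩`, `FS⟨S|R⟩^T` and `FS⟨S|R⟩^V`

Objects are the positive integers; a morphism `r ⟶ l` has `r` roots and `l` leaves, and
`f ≫ g` is the composite `f ∘ g`. -/

variable (P)

/-- The presented forest-skein category `FS⟨S|R⟩`. -/
@[ext] structure Cat (P : SkeinPresentation S) where
  size : ℕ+

/-- The `V`-type category of symmetric forests. -/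
@[ext] structure CatV (P : SkeinPresentation S) where
  size : ℕ+

/-- The `T`-type category of cyclic forests. -/
@[ext] structure CatT (P : SkeinPresentation S) where
  size : ℕ+

instance : Category.{u} P.Cat where
  Hom x y := P.Mor x.size y.size
  id x := Mor.mk (Forest.id S x.size)
  comp f g := Mor.comp f g
  id_comp := Mor.id_comp
  comp_id := Mor.comp_id
  assoc := Mor.comp_assoc

instance : Category.{u} P.CatV where
  Hom x y := P.SymMor x.size y.size
  id x := SymMor.id P x.size
  comp f g := SymMor.comp f g
  id_comp := SymMor.id_comp
  comp_id := SymMor.comp_id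
  assoc := SymMor.comp_assoc

instance : Category.{u} P.CatT where
  Hom x y := {f : P.SymMor x.size y.size // f.perm ∈ cyclic y.size}
  id x := ⟨SymMor.id P x.size, one_mem _⟩
  comp f g := ⟨SymMor.comp f.1 g.1, mul_mem (split_mem_cyclic f.2 _) g.2⟩
  id_comp f := Subtype.ext (SymMor.id_comp f.1)
  comp_id f := Subtype.ext (SymMor.comp_id f.1)
  assoc f g h := Subtype.ext (SymMor.comp_assoc f.1 g.1 h.1)

variable {P}

theorem SymMor.left_cancel (hP : IsOre P.Cat) {r m l : ℕ+} (x : P.SymMor r m)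
    (y z : P.SymMor m l) (e : x.comp y = x.comp z) : y = z := by
  have e1 : Mor.comp x.forest (Mor.perm y.forest x.perm) =
      Mor.comp x.forest (Mor.perm z.forest x.perm) := congrArg SymMor.forest e
  have e2 : Mor.split x.perm y.forest * y.perm = Mor.split x.perm z.forest * z.perm :=
    congrArg SymMor.perm e
  have e3 := hP.left_cancel (x := ⟨r⟩) (y := ⟨m⟩) (z := ⟨l⟩) x.forest _ _ e1
  have e4 : y.forest = z.forest := by
    have := congrArg (fun f => Mor.perm f x.perm⁻¹) e3
    simpa only [← Mor.perm_mul, inv_mul_cancel, Mor.perm_one] using this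
  rw [e4] at e2
  exact SymMor.ext e4 (mul_left_cancel e2)

theorem SymMor.common_right_multiple (hP : IsOre P.Cat) {r m m' : ℕ+} (x : P.SymMor r m)
    (y : P.SymMor r m') : ∃ (l : ℕ+) (p : P.SymMor m l) (q : P.SymMor m' l),
      x.comp p = y.comp q ∧ (x.perm ∈ cyclic m → p.perm ∈ cyclic l) ∧
        (y.perm ∈ cyclic m' → q.perm ∈ cyclic l) := by
  obtain ⟨w, p, q, e⟩ := hP.common_right_multiple (x := ⟨r⟩) (y := ⟨m⟩) (z := ⟨m'⟩)
    x.forest y.forest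
  have e' : Mor.comp x.forest p = Mor.comp y.forest q := e
  have key : ∀ {m : ℕ+} (x : P.SymMor r m) (p : P.Mor m w.size),
      x.comp ⟨p.perm x.perm⁻¹, ((p.perm x.perm⁻¹).split x.perm)⁻¹⟩ = ⟨x.forest.comp p, 1⟩ := by
    intro m x p
    ext1
    · simp only [SymMor.comp, ← Mor.perm_mul, mul_inv_cancel, Mor.perm_one]
    · simp only [SymMor.comp, mul_inv_cancel]
  refine ⟨w.size, _, _, (key x p).trans (Eq.trans ?_ (key y q).symm), ?_, ?_⟩
  · rw [e']
  · exact fun h => inv_mem (split_mem_cyclic h _)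
  · exact fun h => inv_mem (split_mem_cyclic h _)

instance [hP : IsOre P.Cat] : IsOre P.CatV where
  left_cancel f g h e := SymMor.left_cancel hP f g h e
  common_right_multiple f g := by
    obtain ⟨l, p, q, e, -, -⟩ := SymMor.common_right_multiple hP f g
    exact ⟨⟨l⟩, p, q, e⟩

instance [hP : IsOre P.Cat] : IsOre P.CatT where
  left_cancel f g h e :=
    Subtype.ext (SymMor.left_cancel hP f.1 g.1 h.1 (congrArg Subtype.val e))
  common_right_multiple f g := by
    obtain ⟨l, p, q, e, hp, hq⟩ := SymMor.common_right_multiple hP f.1 g.1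
    exact ⟨⟨l⟩, ⟨p, hp f.2⟩, ⟨q, hq g.2⟩, Subtype.ext e⟩

variable (P)

/-- The forest-skein group `G^V`: the isotropy group at `1` of the fraction groupoid of
`FS⟨S|R⟩^V`. -/
abbrev GroupV : Type u := FracGroup (⟨1⟩ : P.CatV)

/-- The forest-skein group `G^T`: the isotropy group at `1` of the fraction groupoid of
`FS⟨S|R⟩^T`. -/
abbrev GroupT : Type u := FracGroup (⟨1⟩ : P.CatT)

variable {P}

/-- The element `[t ∘ π, s] = t ∘ π ∘ s⁻¹` of `G^V`, for free trees `t`, `s` with `n` leaves and a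
permutation `π` of the leaves. -/
def fracV {n : ℕ+} (t : Forest S 1 n) (π : Equiv.Perm (Fin n)) (s : Forest S 1 n) : P.GroupV :=
  FracGroup.frac (y := (⟨n⟩ : P.CatV)) (⟨Mor.mk t, π⟩ : P.SymMor 1 n)
    (⟨Mor.mk s, 1⟩ : P.SymMor 1 n)

/-- The element `[t ∘ π, s] = t ∘ π ∘ s⁻¹` of `G^T`, for free trees `t`, `s` with `n` leaves and a
cyclic permutation `π` of the leaves. -/
def fracT {n : ℕ+} (t : Forest S 1 n) (π : cyclic n) (s : Forest S 1 n) : P.GroupT :=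
  FracGroup.frac (y := (⟨n⟩ : P.CatT)) ⟨(⟨Mor.mk t, π⟩ : P.SymMor 1 n), π.2⟩
    ⟨(⟨Mor.mk s, 1⟩ : P.SymMor 1 n), one_mem _⟩

variable (P)

/-- The abelian group `ℤ^S / ⟨χ(u) = χ(v), a = 0 : (u, v) ∈ R⟩`, where `ℤ^S` is the free abelian
group on `S`. -/
abbrev ColourGroup (a : S) : Type u :=
  (S →₀ ℤ) ⧸ AddSubgroup.closure
    ({x | ∃ p ∈ P.rel, x = p.1.count - p.2.count} ∪ {Finsupp.single a 1})

end SkeinPresentation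

end ForestSkein

/-! Composition of forests adds colour counts, and permuting leaves does not change them, so
counting colours modulo the relations gives homomorphisms `countV` and `countT`. The fraction of a
`b`-caret by an `a`-caret is sent to the generator `b`, which gives surjectivity. The substance is
injectivity: in the abelianisation, a fraction must depend only on the colours of its two trees.

Both groups are treated at once by studying an additive invariant `D` of fractions (`FracEval`)
whose permutations lie in a family `K` containing all rotations. Take the right `a`-comb as
reference tree. Write T(t) for the value of t against the comb with as many leaves, and turn(π) for
the value of the permuted comb against the comb; every value is a combination of these (`val_eq`).
Two trees with equally many leaves keep the same difference of T when the same forest is grafted on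
both (`tree_graft`). Hence the effect of replacing a subtree does not depend on its place below the
root; passing from left to right uses the rotation of two leaves (`below_eq_right`).

Let A and B be the values of the associativity move at the root and below it. Growing a rotation by
one caret relates the rotations of k + 1 and k + 2 leaves (`rot_eq`); comparing these relations for
left combs forces B = 0, and the pentagon gives A = 2B = 0. Trees can now be reassociated freely, so
T is additive in the colours except possibly at the root vertex (`tree_node`). The Ore condition
supplies congruent trees with root colours `b` and `a`, which removes this exception (`tree_caret`).

Once T depends on colours alone, splitting strands preserves turn(π). A rotation then has value
equal to its own double, and a transposition has the value of a product of two transpositions, which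
is trivial in an abelian group. So turn vanishes on cyclic permutations, and on all permutations
when `K` is everything. What remains is a homomorphism from the colours which kills the relations
and `a`, and applying this to the universal invariants `evalT` and `evalV` gives injectivity. -/

namespace ForestSkein

universe u v w

variable {S : Type u}

/-! ### Homomorphisms from fraction groups to abelian groups. -/

namespace FracGroup

variable {C : Type u} [Category.{v} C] {c : C} [IsOre C]

/-- An additive invariant of the morphisms of an Ore category induces a homomorphism on its
fraction groups. -/
noncomputable def degHom {Q : Type w} [AddCommGroup Q] (deg : ∀ {x y : C}, (x ⟶ y) → Q)
    (h : ∀ {x y z : C} (f : x ⟶ y) (g : y ⟶ z), deg (f ≫ g) = deg f + deg g) :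
    FracGroup c →* Multiplicative Q :=
  MonoidHom.mk' (Quot.lift (fun p => Multiplicative.ofAdd (deg p.num - deg p.den)) (by
      rintro _ _ ⟨f, g, p⟩
      simp only [h]
      congr 1
      abel)) (by
      intro x y
      obtain ⟨_, f, g, rfl⟩ := frac_surj x
      obtain ⟨_, k, l, rfl⟩ := frac_surj y
      obtain ⟨w, f', m, k', e1, e2⟩ := frac_common f g k l
      rw [e1, e2, frac_mul_frac]
      change Multiplicative.ofAdd (deg f' - deg k') =
        Multiplicative.ofAdd (deg f' - deg m) * Multiplicative.ofAdd (deg m - deg k')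
      rw [← ofAdd_add]
      congr 1
      abel)

end FracGroup

/-! ### Counting colours -/

theorem Tree.count_graft (t : Tree S) (g : Fin t.leaves → Tree S) :
    (t.graft g).count = t.count + ∑ k, (g k).count := by
  induction t with
  | leaf =>
    rw [Tree.count, zero_add]
    exact (Fin.sum_univ_one fun k => (g k).count).symm
  | node c l r hl hr =>
    have h := Fin.sum_univ_add (a := l.leaves) (b := r.leaves) fun k => (g k).count
    simp only [Tree.graft, Tree.count, hl, hr]
    refine Eq.trans ?_ (congrArg _ h.symm)
    abel

namespace Forest

variable {r l m r' l' : ℕ}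

theorem count_comp (f : Forest S r m) (g : Forest S m l) :
    (f.comp g).count = f.count + g.count := by
  simp only [count, comp, Tree.count_graft, Finset.sum_add_distrib]
  have h := f.leafEquiv.sum_comp fun i => (g.tree i).count
  rw [Fintype.sum_sigma] at h
  rw [h]

theorem count_tensor (f : Forest S r l) (g : Forest S r' l') :
    (f.tensor g).count = f.count + g.count := by
  simp [count, tensor, Fin.sum_univ_add]

theorem count_perm (f : Forest S r l) (π : Equiv.Perm (Fin r)) : (f.perm π).count = f.count :=
  π.symm.sum_comp fun i => (f.tree i).count

theorem count_eq (f : Forest S 1 l) : f.count = (f.tree 0).count :=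
  Fin.sum_univ_one fun i => (f.tree i).count

end Forest

namespace SkeinPresentation

variable {P : SkeinPresentation S} {r l m n : ℕ}

theorem Cong.count_eq (a : S) {f g : Forest S r l} (h : P.Cong f g) :
    (QuotientAddGroup.mk f.count : P.ColourGroup a) = QuotientAddGroup.mk g.count := by
  induction h with
  | @of u v l h hu hv =>
    rw [Forest.count_eq, Forest.count_eq, QuotientAddGroup.eq_iff_sub_mem]
    exact AddSubgroup.subset_closure (Or.inl ⟨(u, v), h, rfl⟩)
  | refl f => rfl
  | symm _ ih => exact ih.symm
  | trans _ _ ih ih' => exact ih.trans ih'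
  | comp _ _ ih ih' =>
    rw [Forest.count_comp, Forest.count_comp, QuotientAddGroup.mk_add, QuotientAddGroup.mk_add,
      ih, ih']
  | tensor _ _ ih ih' =>
    rw [Forest.count_tensor, Forest.count_tensor, QuotientAddGroup.mk_add,
      QuotientAddGroup.mk_add, ih, ih']

/-- The colours of a morphism of `FS⟨S|R⟩`, counted modulo the relations and the colour `a`. -/
noncomputable def Mor.count (a : S) : P.Mor r l → P.ColourGroup a :=
  Quotient.lift (fun f => (QuotientAddGroup.mk f.count : P.ColourGroup a))
    fun _ _ h => Cong.count_eq a h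

theorem Mor.count_mk (a : S) (f : Forest S r l) :
    Mor.count a (Mor.mk f : P.Mor r l) = QuotientAddGroup.mk f.count := rfl

theorem SymMor.count_comp (a : S) (x : P.SymMor r m) (y : P.SymMor m l) :
    Mor.count a (x.comp y).forest = Mor.count a x.forest + Mor.count a y.forest := by
  obtain ⟨x, π⟩ := x
  obtain ⟨y, σ⟩ := y
  obtain ⟨f, rfl⟩ := Mor.mk_surj x
  obtain ⟨g, rfl⟩ := Mor.mk_surj y
  simp only [SymMor.comp, Mor.perm_mk, Mor.comp_mk, Mor.count_mk, Forest.count_comp,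
    Forest.count_perm, QuotientAddGroup.mk_add]

section
variable [IsOre P.Cat]

/-- The colour counting homomorphism on `G^V`. -/
noncomputable def countV (a : S) : P.GroupV →* Multiplicative (P.ColourGroup a) :=
  FracGroup.degHom (fun f => Mor.count a (SymMor.forest f)) (SymMor.count_comp a)

/-- The colour counting homomorphism on `G^T`. -/
noncomputable def countT (a : S) : P.GroupT →* Multiplicative (P.ColourGroup a) :=
  FracGroup.degHom (fun f => Mor.count a (SymMor.forest f.1))
    (fun f g => SymMor.count_comp a f.1 g.1)

end

/-! ### Explicit splittings -/

/-- Rotating the roots carries the block of leaves of the last tree to the front and shifts all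
other leaves by the size of that block. -/
theorem split_finRotate (f : Forest S (r + 1) l) :
    f.split (finRotate (r + 1)) = finRotate l ^ (f.tree (Fin.last r)).leaves := by
  obtain ⟨f', hf⟩ := exists_extend f.tree
  let off : ℕ → ℕ := fun j => ∑ i ∈ Finset.range j, (f' i).leaves
  have hl : off r + (f' r).leaves = l := by
    rw [← f.sum_leaves, ← Finset.sum_range_succ, Finset.sum_range]
    exact Finset.sum_congr rfl fun i _ => by rw [hf]
  have hlast : (0 : ℕ) < (f' r).leaves := Tree.leaves_pos _
  have hr : f.tree (Fin.last r) = f' r := (hf (Fin.last r)).symm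
  rw [hr]
  ext x
  rw [finRotate_pow_val]
  obtain ⟨i, k, rfl⟩ := f.leafEquiv_surj x
  have hk : (k : ℕ) < ((f.perm (finRotate (r + 1))).tree (finRotate (r + 1) i)).leaves := by
    simpa only [Forest.perm, Equiv.symm_apply_apply] using k.2
  rw [Forest.split_apply _ f i k ⟨k, hk⟩ rfl, f.leafEquiv_val f' hf]
  -- The trees of the rotated forest: the last one comes first and the others move one place to the
  -- right.
  let f'' : ℕ → Tree S := fun j => if j = 0 then f' r else f' (j - 1)
  have hf'' : ∀ j : Fin (r + 1), f'' j = (f.perm (finRotate (r + 1))).tree j := by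
    intro j
    obtain ⟨j, rfl⟩ := (finRotate (r + 1)).surjective j
    simp only [Forest.perm, Equiv.symm_apply_apply, f'', coe_finRotate]
    by_cases hj : j = Fin.last r
    · subst hj
      simpa using hf (Fin.last r)
    · simpa [hj] using hf j
  rw [Forest.leafEquiv_val _ f'' hf'', coe_finRotate]
  have h6 : (k : ℕ) < (f' i).leaves := by
    rw [hf i]
    exact k.2
  by_cases hi : i = Fin.last r
  · subst hi
    rw [Fin.val_last] at h6 ⊢
    have : ∑ j ∈ Finset.range r, (f' j).leaves = off r := rfl
    rw [this]
    -- This is the only case where the position wraps around modulo `l`.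
    have e : off r + (k : ℕ) + (f' r).leaves = k + l := by omega
    rw [e, Nat.add_mod_right, Nat.mod_eq_of_lt (by omega)]
    simp
  · have h3 : ∑ j ∈ Finset.range ((i : ℕ) + 1), (f'' j).leaves =
        (∑ j ∈ Finset.range (i : ℕ), (f' j).leaves) + (f' r).leaves := by
      rw [Finset.sum_range_succ']
      simp [f'']
    have hi' : (i : ℕ) < r := Fin.val_lt_last hi
    have h4 : off ((i : ℕ) + 1) ≤ off r :=
      Finset.sum_le_sum_of_subset (Finset.range_mono hi')
    have h5 : off ((i : ℕ) + 1) = off i + (f' i).leaves := Finset.sum_range_succ _ _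
    have h7 : ∑ j ∈ Finset.range (i : ℕ), (f' j).leaves = off i := rfl
    rw [if_neg hi, h3, h7, Nat.mod_eq_of_lt (by omega)]
    simp only
    omega

/-- Splitting every strand in two turns a transposition into a product of two transpositions. -/
theorem split_swap {i j : Fin r} (hij : i ≠ j) (f : Forest S r l)
    (hf : ∀ i, (f.tree i).leaves = 2) :
    ∃ x y z w : Fin l, x ≠ y ∧ z ≠ w ∧
      f.split (Equiv.swap i j) = Equiv.swap x y * Equiv.swap z w := by
  -- The left leaves `L 0` and the right leaves `L 1` form two disjoint copies of the roots, and the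
  -- split permutation acts on each as the original transposition.
  let L (k : Fin 2) (i : Fin r) : Fin l := f.leafEquiv ⟨i, k.cast (hf i).symm⟩
  have hL : ∀ {k k' i i'}, L k i = L k' i' → k = k' ∧ i = i' := by
    intro k k' i i' h
    obtain ⟨h1, h2⟩ := Sigma.mk.inj (f.leafEquiv.injective h)
    subst h1
    exact ⟨Fin.cast_injective _ (eq_of_heq h2), rfl⟩
  have hinj : ∀ k, Function.Injective (L k) := fun k _ _ h => (hL h).2
  have hsplit : ∀ (k : Fin 2) (m : Fin r),
      f.split (Equiv.swap i j) (L k m) = L k (Equiv.swap i j m) := by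
    intro k m
    rw [Forest.split_apply _ f m _ (k.cast (hf _).symm) rfl]
    exact Forest.leafEquiv_congr (f := f.perm (Equiv.swap i j)) (f' := f)
      (fun i => (hf _).trans (hf i).symm) rfl _ _ rfl
  refine ⟨L 0 i, L 0 j, L 1 i, L 1 j, (hinj 0).ne hij, (hinj 1).ne hij, ?_⟩
  ext1 x
  obtain ⟨m, k, rfl⟩ := f.leafEquiv_surj x
  have hx : f.leafEquiv ⟨m, k⟩ = L (k.cast (hf m)) m := rfl
  have hne : ∀ i i', L 0 i ≠ L 1 i' := fun i i' h => absurd (hL h).1 (by decide)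
  rw [hx, hsplit, Equiv.Perm.mul_apply]
  generalize k.cast (hf m) = k
  fin_cases k
  · change L 0 _ = Equiv.swap (L 0 i) (L 0 j) (Equiv.swap (L 1 i) (L 1 j) (L 0 m))
    rw [Equiv.swap_apply_of_ne_of_ne (hne _ _) (hne _ _), (hinj 0).swap_apply]
  · change L 1 _ = Equiv.swap (L 0 i) (L 0 j) (Equiv.swap (L 1 i) (L 1 j) (L 1 m))
    rw [(hinj 1).swap_apply, Equiv.swap_apply_of_ne_of_ne (hne _ _).symm (hne _ _).symm]

end SkeinPresentation

/-! ### Combs and grafting. -/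

/-- The number of leaves, as a positive integer. -/
def Tree.size (t : Tree S) : ℕ+ := ⟨t.leaves, t.leaves_pos⟩

/-- The tree `t` with a caret of colour `a` attached to its leaf number `j`. -/
def Tree.grow (a : S) (t : Tree S) (j : ℕ) : Tree S :=
  t.graft fun k => if (k : ℕ) = j then node a leaf leaf else leaf

/-- The right comb of colour `a` with `k` vertices. -/
def Tree.comb (a : S) : ℕ → Tree S
  | 0 => leaf
  | k + 1 => node a leaf (comb a k)

theorem Tree.leaves_comb (a : S) (k : ℕ) : (Tree.comb a k).leaves = k + 1 := by
  induction k with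
  | zero => rfl
  | succ k ih => simp only [Tree.comb, Tree.leaves, ih]; omega

/-- The right comb with as many leaves as `t`. -/
def Tree.combOf (a : S) (t : Tree S) : Tree S := Tree.comb a (t.leaves - 1)

theorem Tree.leaves_combOf (a : S) (t : Tree S) : (t.combOf a).leaves = t.leaves := by
  have := t.leaves_pos
  rw [Tree.combOf, Tree.leaves_comb]
  omega

/-- The right comb with `n` leaves, as a forest. -/
def Forest.comb (a : S) (n : ℕ+) : Forest S 1 n :=
  Forest.single (Tree.comb a (n - 1)) (by
    rw [Tree.leaves_comb]
    exact Nat.sub_add_cancel n.2)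

theorem Forest.eq_single {l : ℕ} (f : Forest S 1 l) :
    ∃ h : (f.tree 0).leaves = l, f = Forest.single (f.tree 0) h := by
  have h := f.sum_leaves
  rw [Fin.sum_univ_one] at h
  refine ⟨h, ?_⟩
  ext1
  funext i
  rw [Subsingleton.elim i 0]
  rfl

/-- The forest whose trees are the first values of `g`. -/
def Forest.ofFun {m l : ℕ} (g : ℕ → Tree S) (h : ∑ k ∈ Finset.range m, (g k).leaves = l) :
    Forest S m l :=
  ⟨fun k => g k, by rw [← h, Finset.sum_range]⟩

theorem Forest.comp_ofFun {m l : ℕ} (F : Forest S 1 m) (g : ℕ → Tree S)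
    (h : ∑ k ∈ Finset.range m, (g k).leaves = l) :
    (F.comp (Forest.ofFun g h)).tree 0 = (F.tree 0).graft fun k => g k := by
  obtain ⟨h', e⟩ := F.eq_single
  generalize F.tree 0 = t at h' e
  subst e
  change t.graft _ = t.graft _
  congr 1
  funext k
  exact congrArg g (SkeinPresentation.single_leafEquiv_val t h' 0 k)

/-! ### Additive invariants of fractions, normalised by combs. -/

namespace SkeinPresentation

variable {P : SkeinPresentation S}

/-- An additive invariant of the fractions of symmetric forests with permutations in `K`, a family
of subgroups of the symmetric groups which is stable under splitting of strands. -/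
structure FracEval (P : SkeinPresentation S) (K : ∀ n : ℕ, Subgroup (Equiv.Perm (Fin n)))
    (A : Type w) [AddCommGroup A] where
  stable : ∀ {r l : ℕ} {π : Equiv.Perm (Fin r)}, π ∈ K r → ∀ f : P.Mor r l, f.split π ∈ K l
  val : ∀ {n : ℕ+} (x y : P.SymMor 1 n), x.perm ∈ K n → y.perm ∈ K n → A
  val_add : ∀ {n : ℕ+} (x y z : P.SymMor 1 n) (hx : x.perm ∈ K n) (hy : y.perm ∈ K n)
    (hz : z.perm ∈ K n), val x y hx hy + val y z hy hz = val x z hx hz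
  val_comp : ∀ {n m : ℕ+} (x y : P.SymMor 1 n) (hx : x.perm ∈ K n) (hy : y.perm ∈ K n)
    (p : P.SymMor n m) (hp : p.perm ∈ K m),
    val (x.comp p) (y.comp p) (mul_mem (stable hx _) hp) (mul_mem (stable hy _) hp) =
      val x y hx hy

namespace FracEval

variable {K : ∀ n : ℕ, Subgroup (Equiv.Perm (Fin n))} {A : Type w} [AddCommGroup A]
  (D : P.FracEval K A) (a : S)

/-- The value of the fraction of a tree and the comb with as many leaves. -/
def tree (t : Tree S) : A :=
  D.val (n := t.size) ⟨Mor.mk (Forest.single t rfl), 1⟩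
    ⟨Mor.mk (Forest.comb a _), 1⟩ (one_mem _) (one_mem _)

/-- The value of the fraction of a comb with permuted leaves and the comb itself. -/
def turn {n : ℕ+} (π : Equiv.Perm (Fin n)) (hπ : π ∈ K n) : A :=
  D.val ⟨Mor.mk (Forest.comb a n), π⟩ ⟨Mor.mk (Forest.comb a n), 1⟩ hπ (one_mem _)

theorem val_self {n : ℕ+} (x : P.SymMor 1 n) (hx : x.perm ∈ K n) : D.val x x hx hx = 0 := by
  have := D.val_add x x x hx hx hx
  simpa using this

theorem tree_eq {n : ℕ+} (F : Forest S 1 n) :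
    D.tree a (F.tree 0) = D.val ⟨Mor.mk F, 1⟩ ⟨Mor.mk (Forest.comb a n), 1⟩ (one_mem _)
      (one_mem _) := by
  obtain ⟨h, e⟩ := F.eq_single
  generalize F.tree 0 = t at h e
  subst e
  -- Unpacking `n` makes it definitionally equal to `t.size` once its value is substituted.
  obtain ⟨n, hn⟩ := n
  change t.leaves = n at h
  subst h
  rfl

/-- A permutation common to both sides is a growth by the trivial forest with permuted leaves, so it
cancels. -/
theorem val_mul {n : ℕ+} (F G : Forest S 1 n) {π σ τ : Equiv.Perm (Fin n)} (hπ : π ∈ K n)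
    (hσ : σ ∈ K n) (hτ : τ ∈ K n) :
    D.val ⟨Mor.mk F, π * τ⟩ ⟨Mor.mk G, σ * τ⟩ (mul_mem hπ hτ) (mul_mem hσ hτ) =
      D.val ⟨Mor.mk F, π⟩ ⟨Mor.mk G, σ⟩ hπ hσ := by
  rw [← D.val_comp ⟨Mor.mk F, π⟩ ⟨Mor.mk G, σ⟩ hπ hσ ⟨Mor.mk (Forest.id S n), τ⟩ hτ]
  have key : ∀ (F : Forest S 1 n) (π : Equiv.Perm (Fin n)),
      SymMor.comp ⟨Mor.mk F, π⟩ ⟨Mor.mk (Forest.id S n), τ⟩ =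
        (⟨Mor.mk F, π * τ⟩ : P.SymMor 1 n) := by
    intro F π
    ext1
    · exact Mor.comp_id (Mor.mk F)
    · simp only [SymMor.comp, Mor.split_id]
  simp only [key]

theorem turn_mul {n : ℕ+} {π σ : Equiv.Perm (Fin n)} (hπ : π ∈ K n) (hσ : σ ∈ K n) :
    D.turn a (π * σ) (mul_mem hπ hσ) = D.turn a π hπ + D.turn a σ hσ := by
  have h := D.val_mul (Forest.comb a n) (Forest.comb a n) hπ (one_mem _) hσ
  simp only [one_mul] at h
  rw [turn, turn, turn, ← h]
  exact (D.val_add _ _ _ _ _ _).symm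

theorem turn_one {n : ℕ+} : D.turn a (1 : Equiv.Perm (Fin n)) (one_mem _) = 0 := D.val_self _ _

/-- The value of an arbitrary fraction. -/
theorem val_eq {n : ℕ+} (F G : Forest S 1 n) {π σ : Equiv.Perm (Fin n)} (hπ : π ∈ K n)
    (hσ : σ ∈ K n) :
    D.val ⟨Mor.mk F, π⟩ ⟨Mor.mk G, σ⟩ hπ hσ =
      D.tree a (F.tree 0) + D.turn a π hπ - (D.tree a (G.tree 0) + D.turn a σ hσ) := by
  have key : ∀ (F : Forest S 1 n) {π : Equiv.Perm (Fin n)} (hπ : π ∈ K n),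
      D.val ⟨Mor.mk F, π⟩ ⟨Mor.mk (Forest.comb a n), 1⟩ hπ (one_mem _) =
        D.tree a (F.tree 0) + D.turn a π hπ := by
    intro F π hπ
    have h := D.val_mul F (Forest.comb a n) (one_mem _) (one_mem _) hπ
    simp only [one_mul] at h
    rw [tree_eq, turn, ← h]
    exact (D.val_add _ _ _ _ _ _).symm
  rw [← key F hπ, ← key G hσ]
  exact eq_sub_of_add_eq (D.val_add _ _ _ _ _ _)

theorem tree_congr {t s : Tree S} (h : P.TreeCong t s) : D.tree a t = D.tree a s := by
  have e : (Mor.mk (Forest.single t rfl) : P.Mor 1 t.size) =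
      Mor.mk (Forest.single s h.leaves_eq.symm) := Mor.mk_eq.2 (h.cong _ _)
  rw [tree, e]
  exact (D.tree_eq a (n := t.size) (Forest.single s h.leaves_eq.symm)).symm

theorem split_mem (D : P.FracEval K A) {r l : ℕ} {π : Equiv.Perm (Fin r)} (hπ : π ∈ K r)
    (f : Forest S r l) : f.split π ∈ K l := D.stable hπ (Mor.mk f)

/-- Growing a fraction by a forest. -/
theorem turn_split {n m : ℕ+} (F : Forest S 1 n) (f : Forest S n m) {π : Equiv.Perm (Fin n)}
    (hπ : π ∈ K n) :
    D.turn a π hπ = D.tree a ((F.comp (f.perm π)).tree 0) - D.tree a ((F.comp f).tree 0) +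
      D.turn a (f.split π) (D.split_mem hπ f) := by
  -- Growing by `f` turns `(F, π)` into `(F ∘ f^π, π^f)` and `(F, 1)` into `(F ∘ f, 1)`.
  have h := D.val_comp ⟨Mor.mk F, π⟩ ⟨Mor.mk F, 1⟩ hπ (one_mem _) ⟨Mor.mk f, 1⟩ (one_mem _)
  simp only [SymMor.comp, Mor.comp_mk, Mor.perm_mk, Mor.split_mk, mul_one, Forest.perm_one,
    Forest.split_one] at h
  rw [D.val_eq a, D.val_eq a, turn_one, turn_one] at h
  rw [add_zero, add_zero, add_sub_cancel_left] at h
  rw [← h]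
  abel

/-- Both sides are the value of the fraction of `t` by `s`, before and after growing it; the
contributions of the combs cancel. -/
theorem tree_graft {t s : Tree S} (h : t.leaves = s.leaves) (g : ℕ → Tree S) :
    D.tree a (t.graft fun k => g k) - D.tree a (s.graft fun k => g k) =
      D.tree a t - D.tree a s := by
  let n : ℕ+ := t.size
  let m : ℕ+ := (t.graft fun k => g k).size
  have hm : ∑ k ∈ Finset.range n, (g k).leaves = m := by
    rw [Finset.sum_range]
    exact (t.leaves_graft _).symm
  have h := D.val_comp (n := n) ⟨Mor.mk (Forest.single t rfl), 1⟩
    ⟨Mor.mk (Forest.single s h.symm), 1⟩ (one_mem _) (one_mem _)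
    ⟨Mor.mk (Forest.ofFun (l := m) g hm), 1⟩ (one_mem _)
  simp only [SymMor.comp, Mor.comp_mk, Mor.perm_mk, Mor.split_mk, mul_one, Forest.perm_one,
    Forest.split_one] at h
  rw [D.val_eq a, D.val_eq a, turn_one, turn_one, Forest.comp_ofFun, Forest.comp_ofFun] at h
  simpa [Forest.single] using h

theorem tree_comb (k : ℕ) : D.tree a (Tree.comb a k) = 0 := by
  have h := D.tree_eq a (Forest.comb a k.succPNat)
  exact h.trans (D.val_self _ _)

/-! ### Replacing a subtree: independence of its position. -/

open ForestSkein.Tree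

theorem turn_congr {n : ℕ+} {π σ : Equiv.Perm (Fin n)} (h : π = σ) (hπ : π ∈ K n)
    (hσ : σ ∈ K n) : D.turn a π hπ = D.turn a σ hσ := by
  subst h
  rfl

/-- The difference of the values of two trees below a vertex of colour `a`. -/
def below (x y : Tree S) : A := D.tree a (node a x leaf) - D.tree a (node a y leaf)

theorem below_add (x y z : Tree S) : D.below a x y + D.below a y z = D.below a x z :=
  sub_add_sub_cancel _ _ _

/-- By `tree_graft`, exchanging the root colour `b` for `a` costs the same for `x` and for `y`, and
the common right branch `r` can be pruned. -/
theorem tree_node_left (b : S) {x y : Tree S} (h : x.leaves = y.leaves) (r : Tree S) :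
    D.tree a (node b x r) - D.tree a (node b y r) = D.below a x y := by
  have h1 := D.tree_graft a (t := node b leaf leaf) (s := node a leaf leaf) rfl
    fun k => if k = 0 then x else r
  have h2 := D.tree_graft a (t := node b leaf leaf) (s := node a leaf leaf) rfl
    fun k => if k = 0 then y else r
  -- Leaf number `x.leaves`, counted from zero, is the last leaf of both trees, so `r` is attached
  -- to the right branch only.
  have h3 := D.tree_graft a (t := node a x leaf) (s := node a y leaf) (by simp [h])
    fun k => if k = x.leaves then r else leaf
  have e : ∀ t : Tree S, t.leaves = x.leaves →
      (t.graft fun k : Fin t.leaves => if (k : ℕ) = x.leaves then r else leaf) = t := by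
    intro t ht
    refine Eq.trans ?_ t.graft_leaf
    congr 1
    funext k
    exact if_neg (by have := k.2; omega)
  simp [graft, e _ rfl, e _ h.symm, ← h] at h1 h2 h3
  rw [below, ← h3]
  rw [sub_eq_iff_eq_add] at h1 h2
  rw [h1, h2]
  abel

theorem below_graft {t s : Tree S} (h : t.leaves = s.leaves) (g : ℕ → Tree S) :
    D.below a (t.graft fun k => g k) (s.graft fun k => g k) = D.below a t s := by
  have h1 := D.tree_graft a (t := node a t leaf) (s := node a s leaf) (by simp [h])
    fun k => if k < t.leaves then g k else leaf
  have e : ∀ s : Tree S, s.leaves = t.leaves →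
      (s.graft fun k : Fin s.leaves => if (k : ℕ) < t.leaves then g k else leaf) =
        s.graft fun k => g k := by
    intro s hs
    congr 1
    funext k
    exact if_pos (hs ▸ k.2)
  simp only [graft, Fin.val_castAdd, e _ rfl, e _ h.symm] at h1
  simpa [h, below] using h1

theorem below_congr {x y : Tree S} (h : P.TreeCong x y) (z : Tree S) :
    D.below a x z = D.below a y z := by
  have h1 := TreeCong.graft (g := fun k => if k = 0 then x else leaf)
    (g' := fun k => if k = 0 then y else leaf) (TreeCong.refl (P := P) (node a leaf leaf)) (by
      intro k
      by_cases hk : k = 0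
      · simpa [hk] using h
      · simpa [hk] using TreeCong.refl _)
  simp [graft] at h1
  rw [below, below, D.tree_congr a h1]

/-- The position of a subtree below the root does not matter. -/
theorem below_node_left (b : S) {x y : Tree S} (h : x.leaves = y.leaves) (r : Tree S) :
    D.below a (node b x r) (node b y r) = D.below a x y := by
  -- Reassociation lifts `x` to the left child of the root, at a cost independent of `x`; there
  -- `tree_node_left` applies.
  have key : ∀ x : Tree S, _ := fun x =>
    D.tree_graft a (t := node a (node b leaf leaf) leaf) (s := node a leaf (node a leaf leaf)) rfl
      fun k => if k = 0 then x else if k = 1 then r else leaf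
  simp [graft] at key
  have h1 := (key x).trans (key y).symm
  have h2 := D.tree_node_left a a h (node a r leaf)
  rw [below, ← h2]
  rwa [sub_eq_sub_iff_sub_eq_sub] at h1

section
variable (hK : ∀ n, finRotate n ∈ K n)
include hK

/-- Rotating the two leaves of an `a`-caret and growing one of them exchanges the left and the right
position. The rotation terms depend only on numbers of leaves, so they agree for `x` and `y` and
cancel. -/
theorem below_eq_right {x y : Tree S} (h : x.leaves = y.leaves) :
    D.below a x y = D.tree a (node a leaf x) - D.tree a (node a leaf y) := by
  let n : ℕ+ := 2
  let m : ℕ+ := (node a x leaf).size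
  let ρ : Equiv.Perm (Fin n) := finRotate n
  have hρ : ρ ∈ K n := hK n
  let F : Forest S 1 n := Forest.single (node a leaf leaf) rfl
  let f (z : Tree S) (hz : z.leaves = x.leaves) : Forest S n m :=
    Forest.ofFun (fun k => if k = 0 then z else leaf) (by
      change ∑ k ∈ Finset.range 2, _ = (node a x leaf).leaves
      simp [Finset.sum_range_succ, hz])
  have hs : (f x rfl).split ρ = (f y h.symm).split ρ :=
    Forest.split_congr (fun i => by
      change (if (i : ℕ) = 0 then x else leaf).leaves = (if (i : ℕ) = 0 then y else leaf).leaves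
      split_ifs
      exacts [h, rfl]) _
  have h1 := D.turn_split a F (f x rfl) hρ
  have h2 := D.turn_split a F (f y h.symm) hρ
  have e1 : ∀ z hz, (F.comp (f z hz)).tree 0 = node a z leaf := fun z hz => by
    rw [Forest.comp_ofFun]
    rfl
  have e2 : ∀ z hz, (F.comp ((f z hz).perm ρ)).tree 0 = node a leaf z := fun z hz => rfl
  rw [e1 x rfl, e2 x rfl, D.turn_congr a hs _ (D.split_mem hρ (f y h.symm))] at h1
  rw [e1 y h.symm, e2 y h.symm, h1] at h2
  have h3 := add_right_cancel h2
  rw [below, sub_eq_sub_iff_add_eq_add]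
  rw [sub_eq_sub_iff_add_eq_add] at h3
  rw [add_comm, ← h3, add_comm]

theorem tree_node_right (b : S) {x y : Tree S} (h : x.leaves = y.leaves) (r : Tree S) :
    D.tree a (node b r x) - D.tree a (node b r y) = D.below a x y := by
  have h1 := D.tree_graft a (t := node b leaf leaf) (s := node a leaf leaf) rfl
    fun k => if k = 0 then r else x
  have h2 := D.tree_graft a (t := node b leaf leaf) (s := node a leaf leaf) rfl
    fun k => if k = 0 then r else y
  have h3 := D.tree_graft a (t := node a leaf x) (s := node a leaf y) (by simp [h])
    fun k => if k = 0 then r else leaf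
  simp [graft, graft_leaf] at h1 h2 h3
  rw [below_eq_right D a hK h, ← h3]
  rw [sub_eq_iff_eq_add] at h1 h2
  rw [h1, h2]
  abel

theorem below_node_right (b : S) {x y : Tree S} (h : x.leaves = y.leaves) (r : Tree S) :
    D.below a (node b r x) (node b r y) = D.below a x y := by
  have key : ∀ x : Tree S, _ := fun x =>
    D.tree_graft a (t := node a (node b leaf leaf) leaf) (s := node a leaf (node a leaf leaf)) rfl
      fun k => if k = 0 then r else if k = 1 then x else leaf
  simp [graft] at key
  have h1 := (key x).trans (key y).symm
  -- After reassociation the subtree sits in the left branch of the right child of the root.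
  have h2 := D.tree_node_right a hK a (x := node a x leaf) (y := node a y leaf) (by simp [h]) r
  rw [D.below_node_left a a h] at h2
  rw [below, ← h2]
  rwa [sub_eq_sub_iff_sub_eq_sub] at h1

end

end FracEval
end SkeinPresentation

/-! ### Growing rotations by a single caret. -/

/-- The forest with one caret of colour `a`, attached to its root number `J`. -/
def Forest.caretAt (a : S) {n : ℕ} (J : Fin n) : Forest S n (n + 1) where
  tree i := if i = J then Tree.node a Tree.leaf Tree.leaf else Tree.leaf
  sum_leaves := by
    have : ∀ i, (if i = J then Tree.node a Tree.leaf Tree.leaf else Tree.leaf).leaves =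
        1 + if i = J then 1 else 0 := by
      intro i
      split_ifs <;> rfl
    simp [this, Finset.sum_add_distrib]

theorem Forest.caretAt_perm (a : S) {n : ℕ} (J : Fin n) (π : Equiv.Perm (Fin n)) :
    (Forest.caretAt a J).perm π = Forest.caretAt a (π J) := by
  ext1
  funext i
  simp only [Forest.perm, Forest.caretAt, Equiv.symm_apply_eq]

theorem Forest.comp_caretAt (a : S) {n : ℕ} (F : Forest S 1 n) (J : Fin n) :
    (F.comp (Forest.caretAt a J)).tree 0 = (F.tree 0).grow a J := by
  obtain ⟨h', e⟩ := F.eq_single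
  generalize F.tree 0 = t at h' e
  subst e
  change t.graft _ = t.graft _
  congr 1
  funext k
  have := SkeinPresentation.single_leafEquiv_val t h' 0 k
  simp only [Forest.caretAt, Fin.ext_iff, this]

namespace SkeinPresentation
variable {P : SkeinPresentation S}
namespace FracEval

variable {K : ∀ n : ℕ, Subgroup (Equiv.Perm (Fin n))} {A : Type w} [AddCommGroup A]
  (D : P.FracEval K A) (a : S)

open ForestSkein.Tree

/-- The contribution of the colour `b`. -/
def colour (b : S) : A := D.below a (node b leaf leaf) (node a leaf leaf)

/-- The homomorphism given by the contributions of the colours. -/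
noncomputable def colourHom : (S →₀ ℤ) →+ A :=
  Finsupp.liftAddHom fun b => zmultiplesHom A (D.colour a b)

theorem colourHom_single (b : S) : D.colourHom a (Finsupp.single b 1) = D.colour a b := by
  simp [colourHom]

theorem turn_pow {n : ℕ+} {π : Equiv.Perm (Fin n)} (hπ : π ∈ K n) (k : ℕ) :
    D.turn a (π ^ k) (pow_mem hπ k) = k • D.turn a π hπ := by
  induction k with
  | zero => rw [zero_smul]; exact D.turn_one a
  | succ k ih =>
    rw [D.turn_congr a (pow_succ π k) _ (mul_mem (pow_mem hπ k) hπ),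
      D.turn_mul a (pow_mem hπ k) hπ, ih, succ_nsmul]

variable (hK : ∀ n, finRotate n ∈ K n)

/-- The value of the rotation of `k + 1` leaves. -/
def rot (k : ℕ) : A := D.turn a (n := k.succPNat) (finRotate (k + 1)) (hK (k + 1))

/-- This is `turn_split` for one caret. The last strand is the one that wraps around: if it is
doubled, the rotation becomes the square of the next rotation, otherwise the next rotation itself.
-/
theorem rot_eq {k : ℕ} {t : Tree S} (ht : t.leaves = k + 1) (J : Fin (k + 1)) :
    D.rot a hK k = D.tree a (t.grow a (finRotate (k + 1) J)) - D.tree a (t.grow a J) +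
      (if J = Fin.last k then 2 else 1) • D.rot a hK (k + 1) := by
  let n : ℕ+ := k.succPNat
  let m : ℕ+ := (k + 1).succPNat
  let F : Forest S 1 n := Forest.single t ht
  let f : Forest S n m := Forest.caretAt a J
  have h := D.turn_split a F f (hK n)
  have e1 : (F.comp f).tree 0 = t.grow a J := F.comp_caretAt a J
  have e2 : (F.comp (f.perm (finRotate n))).tree 0 = t.grow a (finRotate (k + 1) J) :=
    (congrArg (fun f : Forest S n m => (F.comp f).tree 0)
      (Forest.caretAt_perm a J (finRotate (k + 1)))).trans (F.comp_caretAt a (finRotate (k + 1) J))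
  have e3 : f.split (finRotate n) = finRotate m ^ (if J = Fin.last k then 2 else 1) := by
    refine (split_finRotate (Forest.caretAt a J)).trans ?_
    simp only [Forest.caretAt, eq_comm (a := Fin.last k)]
    split_ifs <;> rfl
  rw [e1, e2, D.turn_congr a e3 _ (pow_mem (hK m) _), D.turn_pow a] at h
  exact h

theorem rot_eq_castSucc {k : ℕ} {t : Tree S} (ht : t.leaves = k + 1) {j : ℕ} (hj : j < k) :
    D.rot a hK k = D.tree a (t.grow a (j + 1)) - D.tree a (t.grow a j) + D.rot a hK (k + 1) := by
  have h := D.rot_eq a hK ht ⟨j, by omega⟩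
  rw [coe_finRotate, if_neg, if_neg, one_smul] at h
  · exact h
  all_goals
    rw [Fin.ext_iff]
    exact hj.ne

theorem rot_eq_last {k : ℕ} {t : Tree S} (ht : t.leaves = k + 1) :
    D.rot a hK k = D.tree a (t.grow a 0) - D.tree a (t.grow a k) + 2 • D.rot a hK (k + 1) := by
  have h := D.rot_eq a hK ht (Fin.last k)
  rw [coe_finRotate, if_pos rfl, if_pos rfl] at h
  exact h

/-! ### Vanishing of the associativity moves. -/

/-- The value of the associativity move at the root. -/
def assoc : A :=
  D.tree a (node a (node a leaf leaf) leaf) - D.tree a (node a leaf (node a leaf leaf))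

theorem tree_assoc (x y z : Tree S) :
    D.tree a (node a (node a x y) z) - D.tree a (node a x (node a y z)) = D.assoc a := by
  have h := D.tree_graft a (t := node a (node a leaf leaf) leaf)
    (s := node a leaf (node a leaf leaf)) rfl
    fun k => if k = 0 then x else if k = 1 then y else z
  simpa [graft, assoc] using h

/-- The value of the associativity move below the root. -/
def assocBelow : A :=
  D.below a (node a (node a leaf leaf) leaf) (node a leaf (node a leaf leaf))

theorem below_assoc (x y z : Tree S) :
    D.below a (node a (node a x y) z) (node a x (node a y z)) = D.assocBelow a := by
  have h := D.below_graft a (t := node a (node a leaf leaf) leaf)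
    (s := node a leaf (node a leaf leaf)) rfl
    fun k => if k = 0 then x else if k = 1 then y else z
  simpa [graft, assocBelow] using h

include hK

/-- The pentagon of `a`-coloured trees with four leaves: one path from the left comb to the right
comb makes two moves at the root, the other makes one at the root and two below it. -/
theorem assoc_eq : D.assoc a = D.assocBelow a + D.assocBelow a := by
  have h1 := D.tree_assoc a (node a leaf leaf) leaf leaf
  have h2 := D.tree_assoc a leaf leaf (node a leaf leaf)
  have h3 : _ = D.assocBelow a := D.tree_node_left a a (x := node a (node a leaf leaf) leaf)
    (y := node a leaf (node a leaf leaf)) rfl leaf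
  have h4 := D.tree_assoc a leaf (node a leaf leaf) leaf
  have h5 : _ = D.assocBelow a := D.tree_node_right a hK a (x := node a (node a leaf leaf) leaf)
    (y := node a leaf (node a leaf leaf)) rfl leaf
  rw [sub_eq_iff_eq_add] at h1 h2 h3 h4 h5
  rw [h2] at h1
  rw [h1, h4, h5] at h3
  refine add_left_cancel (a := D.assoc a + D.tree a (node a leaf (node a leaf
    (node a leaf leaf)))) ?_
  refine Eq.trans ?_ (h3.trans ?_) <;> abel

/-- On a left comb, a caret at leaf 0 differs from one at leaf 1 by a move below the root, and from
one at the last leaf by a move at the root. So `rot_eq` at these leaves involves only rotations and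
the two associativity values. -/
theorem assocBelow_eq_zero : D.assocBelow a = 0 := by
  let t : Tree S := node a (node a leaf leaf) leaf
  have h1 := D.rot_eq_castSucc a hK (k := 2) (t := t) rfl (j := 0) (by omega)
  have h2 := D.rot_eq_last a hK (k := 2) (t := t) rfl
  have h3 := D.rot_eq_castSucc a hK (k := 3) (t := node a t leaf) rfl (j := 0) (by omega)
  have h4 := D.rot_eq_last a hK (k := 3) (t := node a t leaf) rfl
  simp [grow, graft, t] at h1 h2 h3 h4
  have e2 := D.tree_assoc a (node a leaf leaf) leaf leaf
  have e4 := D.tree_assoc a (node a (node a leaf leaf) leaf) leaf leaf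
  have e1 : _ = D.assocBelow a := D.tree_node_left a a (x := node a (node a leaf leaf) leaf)
    (y := node a leaf (node a leaf leaf)) rfl leaf
  have e3 := D.tree_node_left a a (x := node a (node a (node a leaf leaf) leaf) leaf)
    (y := node a (node a leaf (node a leaf leaf)) leaf) rfl leaf
  rw [D.below_node_left a a (x := node a (node a leaf leaf) leaf)
    (y := node a leaf (node a leaf leaf)) rfl] at e3
  change _ = D.assocBelow a at e3
  rw [← neg_sub, e1] at h1
  rw [← neg_sub, e3] at h3
  rw [e2] at h2
  rw [e4] at h4
  -- With A and B the moves at and below the root, `h1` and `h2` give `rot 3 = -(A + B)`, while `h3`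
  -- and `h4` give `rot 4 = -(A + B)`. Since `h3` reads `rot 3 = rot 4 - B`, it follows that B = 0.
  grind


end FracEval
end SkeinPresentation

theorem Tree.count_grow (a : S) (t : Tree S) {j : ℕ} (hj : j < t.leaves) :
    (t.grow a j).count = t.count + Finsupp.single a 1 := by
  rw [Tree.grow, Tree.count_graft]
  congr 1
  rw [Finset.sum_eq_single (⟨j, hj⟩ : Fin t.leaves)]
  · simp [Tree.count]
  · intro k _ hk
    rw [if_neg fun h => hk (Fin.ext h)]
    rfl
  · simp

/-! ### The value of a tree in terms of its colours. -/

namespace SkeinPresentation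
variable {P : SkeinPresentation S}

/-- A common right multiple of the two one-vertex trees; it is used to compare root colours in
`tree_caret`. -/
theorem exists_treeCong [hP : IsOre P.Cat] (a b : S) :
    ∃ p p' q q' : Tree S, P.TreeCong (Tree.node b p p') (Tree.node a q q') := by
  obtain ⟨w, p, q, e⟩ := hP.common_right_multiple (x := ⟨1⟩) (y := ⟨2⟩) (z := ⟨2⟩)
    (Mor.mk (Forest.single (Tree.node b Tree.leaf Tree.leaf) rfl) : P.Mor 1 2)
    (Mor.mk (Forest.single (Tree.node a Tree.leaf Tree.leaf) rfl) : P.Mor 1 2)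
  obtain ⟨p, rfl⟩ := Mor.mk_surj (P := P) p
  obtain ⟨q, rfl⟩ := Mor.mk_surj (P := P) q
  exact ⟨_, _, _, _, (Mor.mk_eq.1 e).treeCong 0⟩

namespace FracEval

variable {K : ∀ n : ℕ, Subgroup (Equiv.Perm (Fin n))} {A : Type w} [AddCommGroup A]
  (D : P.FracEval K A) (a : S)

open ForestSkein.Tree

theorem below_self (t : Tree S) : D.below a t t = 0 := sub_self _

variable (hK : ∀ n, finRotate n ∈ K n)
include hK

theorem assoc_eq_zero : D.assoc a = 0 := by
  rw [D.assoc_eq a hK, D.assocBelow_eq_zero a hK, add_zero]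

/-- Associativity moves, which now cost nothing below the root, merge two combs joined by an
`a`-vertex into one comb. -/
theorem below_node_comb (k m : ℕ) :
    D.below a (node a (comb a k) (comb a m)) (comb a (k + m + 1)) = 0 := by
  induction k generalizing m with
  | zero =>
    rw [zero_add]
    exact D.below_self a _
  | succ k ih =>
    rw [show k + 1 + m + 1 = (k + m + 1) + 1 by omega]
    simp only [comb]
    rw [← D.below_add a _ (node a leaf (node a (comb a k) (comb a m))), D.below_assoc,
      D.assocBelow_eq_zero a hK, zero_add, ← ih m]
    refine D.below_node_right a hK a ?_ leaf
    simp only [leaves, leaves_comb]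
    omega

theorem tree_node_comb (k m : ℕ) : D.tree a (node a (comb a k) (comb a m)) = 0 := by
  cases k with
  | zero => exact D.tree_comb a (m + 1)
  | succ k =>
    have h1 := D.tree_assoc a leaf (comb a k) (comb a m)
    have h2 := D.tree_node_right a hK a (x := node a (comb a k) (comb a m))
      (y := comb a (k + m + 1)) (by simp only [leaves, leaves_comb]; omega) leaf
    have h3 : D.tree a (node a leaf (comb a (k + m + 1))) = 0 := D.tree_comb a (k + m + 1 + 1)
    rw [D.below_node_comb a hK, h3, sub_zero] at h2
    rw [h2, D.assoc_eq_zero a hK, sub_zero] at h1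
    exact h1

theorem below_combOf (t : Tree S) : D.below a t (t.combOf a) = D.colourHom a t.count := by
  induction t with
  | leaf =>
    rw [count, map_zero]
    exact D.below_self a leaf
  | node b l r hl hr =>
    -- Recolouring the root from `b` to `a` contributes `colour b`; the two branches are then
    -- straightened into combs one at a time, and the combs merged.
    have h1 := D.below_graft a (t := node b leaf leaf) (s := node a leaf leaf) rfl
      fun k => if k = 0 then l else r
    simp [graft] at h1
    have h2 := D.below_node_left a a (l.leaves_combOf a).symm r
    have h3 := D.below_node_right a hK a (r.leaves_combOf a).symm (l.combOf a)
    have h4 := D.below_node_comb a hK (l.leaves - 1) (r.leaves - 1)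
    have h5 : (node b l r).combOf a = comb a (l.leaves - 1 + (r.leaves - 1) + 1) := by
      have := l.leaves_pos
      have := r.leaves_pos
      rw [combOf, leaves]
      congr 1
      omega
    rw [h5, ← D.below_add a _ (node a l r), ← D.below_add a (node a l r) (node a (l.combOf a) r),
      ← D.below_add a (node a (l.combOf a) r) (node a (l.combOf a) (r.combOf a)), h1, h2, h3,
      hl, hr]
    simp only [combOf, h4]
    rw [count, map_add, map_add, colourHom_single, colour]
    abel

/-- The branches lie below the root and contribute through `below_combOf`. The root is not below
anything, so its caret still has an undetermined value. -/
theorem tree_node (b : S) (l r : Tree S) :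
    D.tree a (node b l r) =
      D.tree a (node b leaf leaf) + D.colourHom a l.count + D.colourHom a r.count := by
  have h1 := D.tree_graft a (t := node b leaf leaf) (s := node a leaf leaf) rfl
    fun k => if k = 0 then l else r
  simp [graft] at h1
  have h2 := D.tree_node_left a a (l.leaves_combOf a).symm r
  have h3 := D.tree_node_right a hK a (r.leaves_combOf a).symm (l.combOf a)
  have h4 : D.tree a (node a (l.combOf a) (r.combOf a)) = 0 := D.tree_node_comb a hK _ _
  have h5 : D.tree a (node a leaf leaf) = 0 := D.tree_comb a 1
  rw [below_combOf D a hK] at h2 h3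
  rw [h4, sub_zero] at h3
  rw [h3, sub_eq_iff_eq_add] at h2
  rw [h5, sub_zero, h2, sub_eq_iff_eq_add] at h1
  rw [h1]
  abel

/-- Evaluate a congruence between trees with root colours `b` and `a` both at the root and below an
`a`-vertex. The branches contribute equally to the two equations and `a` contributes zero, so the
two values of the `b`-caret agree. -/
theorem tree_caret [IsOre P.Cat] (b : S) : D.tree a (node b leaf leaf) = D.colour a b := by
  obtain ⟨p, p', q, q', h⟩ := exists_treeCong (P := P) a b
  have h1 := D.tree_congr a h
  have h2 := D.below_congr a h ((node b p p').combOf a)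
  have h3 : (node b p p').combOf a = (node a q q').combOf a := by
    rw [combOf, combOf, h.leaves_eq]
  have h4 : D.tree a (node a leaf leaf) = 0 := D.tree_comb a 1
  have h5 : D.colour a a = 0 := D.below_self a _
  rw [D.below_combOf a hK, h3, D.below_combOf a hK] at h2
  simp only [count, map_add, colourHom_single, h5] at h2
  rw [D.tree_node a hK b p p', D.tree_node a hK a q q', h4, ← h2] at h1
  exact add_right_cancel (add_right_cancel h1)

/-- The value of a tree is determined by its colours. -/
theorem tree_eq_colourHom [IsOre P.Cat] (t : Tree S) :
    D.tree a t = D.colourHom a t.count := by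
  cases t with
  | leaf =>
    rw [count, map_zero]
    exact D.tree_comb a 0
  | node b l r =>
    rw [D.tree_node a hK, D.tree_caret a hK, count, map_add, map_add, colourHom_single]

/-! ### Vanishing of the permutations. -/

/-- The tree terms of `turn_split` cancel, because `f` and `f^π` have the same colours. -/
theorem turn_eq_split [IsOre P.Cat] {n m : ℕ+} (f : Forest S n m) {π : Equiv.Perm (Fin n)}
    (hπ : π ∈ K n) : D.turn a π hπ = D.turn a (f.split π) (D.split_mem hπ f) := by
  have h := D.turn_split a (Forest.comb a n) f hπ
  rwa [D.tree_eq_colourHom a hK, D.tree_eq_colourHom a hK, ← Forest.count_eq, ← Forest.count_eq,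
    Forest.count_comp, Forest.count_comp, Forest.count_perm, sub_self, zero_add] at h

theorem rot_eq_zero [IsOre P.Cat] (k : ℕ) : D.rot a hK k = 0 := by
  have h1 : ∀ k, D.rot a hK k = 2 • D.rot a hK (k + 1) := fun k => by
    have ht := leaves_comb a k
    have h := D.rot_eq_last a hK ht
    rwa [D.tree_eq_colourHom a hK, D.tree_eq_colourHom a hK, count_grow _ _ (by omega),
      count_grow _ _ (by omega), sub_self, zero_add] at h
  -- The shift by one ensures at least two leaves, so that leaf 0 is not the last.
  have h2 : ∀ k, D.rot a hK (k + 1) = D.rot a hK (k + 2) := fun k => by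
    have ht := leaves_comb a (k + 1)
    have h := D.rot_eq_castSucc a hK ht k.succ_pos
    rwa [D.tree_eq_colourHom a hK, D.tree_eq_colourHom a hK, count_grow _ _ (by omega),
      count_grow _ _ (by omega), sub_self, zero_add] at h
  have h3 : ∀ k, D.rot a hK (k + 2) = 0 := fun k => by
    have h := h1 (k + 1)
    rw [h2 k, two_nsmul] at h
    exact left_eq_add.1 h
  rw [h1, h2, h3, smul_zero]

theorem turn_cyclic [IsOre P.Cat] {n : ℕ+} {π : Equiv.Perm (Fin n)} (hπ : π ∈ cyclic n)
    (hπ' : π ∈ K n) : D.turn a π hπ' = 0 := by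
  obtain ⟨k, rfl⟩ := mem_powers_iff_mem_zpowers.2 hπ
  have h := D.turn_pow a (hK n) k
  rw [h]
  obtain ⟨k, rfl⟩ : ∃ k : ℕ, n = k.succPNat := ⟨n.natPred, n.succPNat_natPred.symm⟩
  rw [show D.turn a (finRotate k.succPNat) (hK _) = D.rot a hK k from rfl,
    D.rot_eq_zero a hK, smul_zero]

theorem turn_top [IsOre P.Cat] (hT : ∀ n, K n = ⊤) {n : ℕ+} (π : Equiv.Perm (Fin n))
    (hπ : π ∈ K n) : D.turn a π hπ = 0 := by
  have hmem : ∀ {n : ℕ+} (π : Equiv.Perm (Fin n)), π ∈ K n := fun {n} π => by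
    rw [hT]
    trivial
  let F (n : ℕ+) : Equiv.Perm (Fin n) →* Multiplicative A :=
    { toFun := fun π => Multiplicative.ofAdd (D.turn a π (hmem π))
      map_one' := D.turn_one a
      map_mul' := fun π σ => D.turn_mul a (hmem π) (hmem σ) }
  -- Transpositions are conjugate, so they have the same image in an abelian group, and that image
  -- squares to 1.
  have hswap : ∀ {n : ℕ+} {x y z w : Fin n}, x ≠ y → z ≠ w →
      F n (Equiv.swap x y * Equiv.swap z w) = 1 := by
    intro n x y z w hxy hzw
    have h := (F n).map_isConj (Equiv.Perm.isConj_swap hxy hzw)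
    rw [isConj_iff_eq] at h
    rw [map_mul, h, ← map_mul, Equiv.swap_mul_self, map_one]
  have hsplit : ∀ {i j : Fin n}, i ≠ j → F n (Equiv.swap i j) = 1 := by
    intro i j hij
    -- A caret on every root doubles every strand, so that `split_swap` applies.
    let f : Forest S n (n + n : ℕ+) :=
      ⟨fun _ => node a leaf leaf, by simp [mul_two]⟩
    obtain ⟨x, y, z, w, hxy, hzw, e⟩ := split_swap hij f fun _ => rfl
    have h := D.turn_eq_split a hK f (hmem (Equiv.swap i j))
    rw [D.turn_congr a e _ (hmem _)] at h
    exact h.trans (hswap hxy hzw)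
  have h : F n π = 1 := by
    induction π using Equiv.Perm.swap_induction_on with
    | one => exact map_one _
    | swap_mul f x y hxy ih => rw [map_mul, hsplit hxy, ih (hmem _), one_mul]
  exact h

/-- Congruent trees have equal values, so `colourHom` kills the skein relations; it kills `a`
because the reference combs are `a`-coloured. -/
theorem colourHom_eq [IsOre P.Cat] {x y : S →₀ ℤ}
    (h : (QuotientAddGroup.mk x : P.ColourGroup a) = QuotientAddGroup.mk y) :
    D.colourHom a x = D.colourHom a y := by
  rw [← sub_eq_zero, ← map_sub, ← AddMonoidHom.mem_ker]
  rw [QuotientAddGroup.eq_iff_sub_mem] at h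
  refine (AddSubgroup.closure_le _).2 ?_ h
  rintro _ (⟨p, hp, rfl⟩ | rfl)
  · rw [SetLike.mem_coe, AddMonoidHom.mem_ker, map_sub, sub_eq_zero,
      ← D.tree_eq_colourHom a hK, ← D.tree_eq_colourHom a hK]
    exact D.tree_congr a (TreeCong.of hp)
  · rw [SetLike.mem_coe, AddMonoidHom.mem_ker, colourHom_single]
    exact D.below_self a _

theorem val_eq_zero [IsOre P.Cat] {n : ℕ+} {x y : P.SymMor 1 n} (hx : x.perm ∈ K n)
    (hy : y.perm ∈ K n) (hx' : D.turn a x.perm hx = 0) (hy' : D.turn a y.perm hy = 0)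
    (h : Mor.count a x.forest = Mor.count a y.forest) : D.val x y hx hy = 0 := by
  obtain ⟨x, π⟩ := x
  obtain ⟨y, σ⟩ := y
  obtain ⟨f, rfl⟩ := Mor.mk_surj x
  obtain ⟨g, rfl⟩ := Mor.mk_surj y
  rw [D.val_eq a, hx', hy', D.tree_eq_colourHom a hK, D.tree_eq_colourHom a hK,
    ← Forest.count_eq, ← Forest.count_eq, D.colourHom_eq a hK h, sub_self]

end FracEval

/-! ### Bijectivity of colour counting on the abelianisations. -/

theorem surjective_of_single {a : S} {H : Type v} [Group H]
    (φ : H →* Multiplicative (P.ColourGroup a))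
    (h : ∀ b, ∃ g, φ g = Multiplicative.ofAdd (QuotientAddGroup.mk (Finsupp.single b 1))) :
    Function.Surjective φ := by
  intro q
  obtain ⟨x, hx⟩ := QuotientAddGroup.mk_surjective q.toAdd
  obtain rfl : Multiplicative.ofAdd (QuotientAddGroup.mk x) = q := congrArg Multiplicative.ofAdd hx
  clear hx
  induction x using Finsupp.induction_linear with
  | zero => exact ⟨1, map_one φ⟩
  | add f g hf hg =>
    obtain ⟨x, hx⟩ := hf
    obtain ⟨y, hy⟩ := hg
    exact ⟨x * y, by rw [map_mul, hx, hy]; rfl⟩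
  | single b k =>
    obtain ⟨x, hx⟩ := h b
    refine ⟨x ^ k, ?_⟩
    rw [map_zpow, hx, ← ofAdd_zsmul, ← QuotientAddGroup.mk_zsmul]
    simp

theorem mk_single_sub (P : SkeinPresentation S) (a b : S) :
    (QuotientAddGroup.mk (Finsupp.single b 1 - Finsupp.single a 1) : P.ColourGroup a) =
      QuotientAddGroup.mk (Finsupp.single b 1) := by
  rw [QuotientAddGroup.eq_iff_sub_mem, sub_sub_cancel_left]
  exact neg_mem (AddSubgroup.subset_closure (Or.inr rfl))

/-- A tree with one vertex. -/
def caret (b : S) : Forest S 1 (2 : ℕ+) :=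
  Forest.single (Tree.node b Tree.leaf Tree.leaf) rfl

theorem count_caret (b : S) : (caret b).count = Finsupp.single b 1 := by
  rw [Forest.count_eq]
  simp [caret, Forest.single, Tree.count]

section
variable [IsOre P.Cat]

theorem countV_fracV (a : S) {n : ℕ+} (t s : Forest S 1 n) (π : Equiv.Perm (Fin n)) :
    countV a (fracV (P := P) t π s) =
      Multiplicative.ofAdd (QuotientAddGroup.mk (t.count - s.count)) := rfl

theorem countT_fracT (a : S) {n : ℕ+} (t s : Forest S 1 n) (π : cyclic n) :
    countT a (fracT (P := P) t π s) =
      Multiplicative.ofAdd (QuotientAddGroup.mk (t.count - s.count)) := rfl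

variable (P) in
/-- The universal additive invariant of the fractions of `G^V`. -/
noncomputable def evalV :
    P.FracEval (fun _ => ⊤) (Additive (Abelianization P.GroupV)) where
  stable _ _ := trivial
  val {n} x y _ _ := Additive.ofMul (Abelianization.of
    (FracGroup.frac (c := (⟨1⟩ : P.CatV)) (y := ⟨n⟩) x y))
  val_add {n} x y z _ _ _ :=
    congrArg (fun g => Additive.ofMul (Abelianization.of g))
      (FracGroup.frac_mul_frac (c := (⟨1⟩ : P.CatV)) (y := ⟨n⟩) x y z)
  val_comp {n m} x y _ _ p _ :=
    congrArg (fun g => Additive.ofMul (Abelianization.of g))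
      (FracGroup.frac_grow (c := (⟨1⟩ : P.CatV)) (y := ⟨n⟩) (z := ⟨m⟩) x y p)

/-- A symmetric forest with a cyclic permutation, as a morphism of the `T`-type category. -/
def CatT.ofSymMor {n m : ℕ+} (x : P.SymMor n m) (hx : x.perm ∈ cyclic m) :
    (⟨n⟩ : P.CatT) ⟶ ⟨m⟩ := ⟨x, hx⟩

variable (P) in
/-- The universal additive invariant of the fractions of `G^T`. -/
noncomputable def evalT :
    P.FracEval cyclic (Additive (Abelianization P.GroupT)) where
  stable := split_mem_cyclic
  val {n} x y hx hy := Additive.ofMul (Abelianization.of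
    (FracGroup.frac (c := (⟨1⟩ : P.CatT)) (y := ⟨n⟩) (CatT.ofSymMor x hx) (CatT.ofSymMor y hy)))
  val_add {n} x y z hx hy hz :=
    congrArg (fun g => Additive.ofMul (Abelianization.of g))
      (FracGroup.frac_mul_frac (c := (⟨1⟩ : P.CatT)) (y := ⟨n⟩)
        (CatT.ofSymMor x hx) (CatT.ofSymMor y hy) (CatT.ofSymMor z hz))
  val_comp {n m} x y hx hy p hp :=
    congrArg (fun g => Additive.ofMul (Abelianization.of g))
      (FracGroup.frac_grow (c := (⟨1⟩ : P.CatT)) (y := ⟨n⟩) (z := ⟨m⟩)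
        (CatT.ofSymMor x hx) (CatT.ofSymMor y hy) (CatT.ofSymMor p hp))

/-- The class of a fraction is by definition its value under `evalV`, so `val_eq_zero` shows that
the kernel is trivial. -/
theorem bijective_lift_countV (a : S) :
    Function.Bijective (Abelianization.lift (countV (P := P) a)) := by
  constructor
  · rw [injective_iff_map_eq_one]
    intro g hg
    obtain ⟨g, rfl⟩ := QuotientGroup.mk_surjective g
    obtain ⟨⟨n⟩, x, y, rfl⟩ := FracGroup.frac_surj g
    refine congrArg Additive.toMul ?_
    exact (evalV P).val_eq_zero (x := x) (y := y) a (fun _ => trivial) trivial trivial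
      ((evalV P).turn_top a (fun _ => trivial) (fun _ => rfl) _ _)
      ((evalV P).turn_top a (fun _ => trivial) (fun _ => rfl) _ _) (sub_eq_zero.1 hg)
  -- This fraction counts to `b - a`, and `a` is zero in the quotient.
  · refine surjective_of_single _ fun b => ⟨Abelianization.of (fracV (caret b) 1 (caret a)), ?_⟩
    rw [Abelianization.lift_apply_of, countV_fracV, count_caret, count_caret, mk_single_sub]

theorem bijective_lift_countT (a : S) :
    Function.Bijective (Abelianization.lift (countT (P := P) a)) := by
  constructor
  · rw [injective_iff_map_eq_one]
    intro g hg
    obtain ⟨g, rfl⟩ := QuotientGroup.mk_surjective g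
    obtain ⟨⟨n⟩, ⟨x, hx⟩, ⟨y, hy⟩, rfl⟩ := FracGroup.frac_surj g
    have hK : ∀ n, finRotate n ∈ cyclic n := fun n => Subgroup.mem_zpowers _
    refine congrArg Additive.toMul ?_
    exact (evalT P).val_eq_zero a hK hx hy ((evalT P).turn_cyclic a hK hx _)
      ((evalT P).turn_cyclic a hK hy _) (sub_eq_zero.1 hg)
  · refine surjective_of_single _ fun b => ⟨Abelianization.of (fracT (caret b) 1 (caret a)), ?_⟩
    rw [Abelianization.lift_apply_of, countT_fracT, count_caret, count_caret, mk_single_sub]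

end

end SkeinPresentation
end ForestSkein

theorem theoremE {S : Type*} (P : ForestSkein.SkeinPresentation S) [ForestSkein.IsOre P.Cat]
    (a : S) :
    ∃ (φT : Abelianization P.GroupT ≃* Multiplicative (P.ColourGroup a))
      (φV : Abelianization P.GroupV ≃* Multiplicative (P.ColourGroup a)),
      (∀ (n : ℕ+) (t s : ForestSkein.Forest S 1 n) (π : ForestSkein.SkeinPresentation.cyclic n),
        φT (Abelianization.of (ForestSkein.SkeinPresentation.fracT t π s)) =
          Multiplicative.ofAdd (QuotientAddGroup.mk (t.count - s.count))) ∧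
      (∀ (n : ℕ+) (t s : ForestSkein.Forest S 1 n) (π : Equiv.Perm (Fin n)),
        φV (Abelianization.of (ForestSkein.SkeinPresentation.fracV t π s)) =
          Multiplicative.ofAdd (QuotientAddGroup.mk (t.count - s.count))) :=
  ⟨MulEquiv.ofBijective _ (ForestSkein.SkeinPresentation.bijective_lift_countT a),
    MulEquiv.ofBijective _ (ForestSkein.SkeinPresentation.bijective_lift_countV a),
    fun _ t s π => ForestSkein.SkeinPresentation.countT_fracT a t s π,
    fun _ t s π => ForestSkein.SkeinPresentation.countV_fracV a t s π⟩
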